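/- Let $(G,H)$ be one of the three model pairs $G=\mathrm{SO}_o(4,1)$ (de Sitter), $G=\mathrm{ISO}_o(3,1)$ (Minkowski), $G=\mathrm{SO}_o(3,2)$ (anti-de Sitter), with $H=\mathrm{SO}_o(3,1)$, where the subscript $o$ denotes the connected component of the identity. Let $\mathfrak g=\mathfrak h\oplus\mathfrak p$ be the $H$-invariant splitting with $\mathfrak h=\mathrm{Lie}(H)$ and $\mathfrak p\cong\mathbb R^{3,1}$. Let $(\pi\colon P\to M,A)$ be a Cartan geometry modeled on $(G,H)$: $\pi$ is a smooth principal right $H$-bundle over a smooth 4-manifold $M$, and $A$ is a smooth $\mathfrak g$-valued 1-form on $P$ such that every $A_p\colon T_pP\to\mathfrak g$ is a linear isomorphism, $R_h^*A=\mathrm{Ad}(h^{-1})\circ A$ for all $h\in H$, and $A$ restricts to the left-invariant Maurer–Cartan form of $H$ on the fibres. Write $A=\omega+e$ with $\omega$ the $\mathfrak h$-part and $e$ the $\mathfrak p$-part. The form $e$ identifies $TM$ with $P\times_H\mathfrak p$ (by $d\pi(w)\mapsto[p,e(w)]$ for $w\in T_pP$), and so the principal connection $\omega$ induces a linear connection $\nabla$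 on $TM$. A development of a smooth path $\gamma\colon[0,1]\to M$ is a path $\sigma\colon[0,1]\to G/H$, $\sigma(t)=g(t)H$, where $C\colon[0,1]\to P$ is a smooth path with $\pi\circ C=\gamma$ and $g\colon[0,1]\to G$ solves $g^{-1}\dot g=A(\dot C)$ (it is unique up to the action of $G$ on $G/H$). Then, for every smooth path $\gamma\colon[0,1]\to M$ and every development $\sigma$ of $\gamma$: $\gamma$ is a geodesic of $\nabla$ (that is, $\nabla_{\dot\gamma}\dot\gamma=0$) if and only if $\sigma$ is a geodesic of the symmetric space $G/H$ (that is, of the Levi-Civita connection of its $G$-invariant Lorentzian metric, which is unique up to scale). -/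

import Mathlib

open Set Filter
open scoped Topology Manifold ContDiff RightActions

noncomputable section

namespace SpacetimeCartan

/-! ### The model spacetimes and their groups -/

/-- The three homogeneous model spacetimes of dimension `3 + 1`. -/
inductive Model
  | deSitter
  | minkowski
  | antiDeSitter

/-- The sign of the cosmological constant. -/
def Model.sign : Model → ℝ
  | .deSitter => 1
  | .minkowski => 0
  | .antiDeSitter => -1

/-- Index set of `ℝ⁵ = ℝ⁴ ⊕ ℝ`. -/
abbrev Idx : Type := Fin 4 ⊕ Fin 1

/-- Real `5 × 5` matrices. -/
abbrev Mat : Type := Matrix Idx Idx ℝ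

/-- The entries of a matrix, as a point of the normed space `ℝ^25`; used to differentiate
matrix-valued maps. -/
def ent (X : Mat) : Idx → Idx → ℝ := fun i j => X i j

/-- The Minkowski form of signature `(3,1)`. -/
def eta : Matrix (Fin 4) (Fin 4) ℝ := Matrix.diagonal ![-1, 1, 1, 1]

/-- The Gram matrix `diag(-1, 1, 1, 1, s)` of the ambient bilinear form on `ℝ⁵`. Its signature is
`(4,1)` for de Sitter and `(3,2)` for anti-de Sitter. For Minkowski it is degenerate, and is used
only on differences of points of an affine hyperplane, where it is the Minkowski form. -/
def ambient (k : Model) : Mat := Matrix.fromBlocks eta 0 0 (Matrix.diagonal fun _ => k.sign)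

/-- The special pseudo-orthogonal group of a bilinear form with Gram matrix `b`. -/
def specialOrthogonal {n : Type} [Fintype n] [DecidableEq n] (b : Matrix n n ℝ) :
    Subgroup (GL n ℝ) where
  carrier := {g | (g : Matrix n n ℝ).transpose * b * (g : Matrix n n ℝ) = b ∧
    (g : Matrix n n ℝ).det = 1}
  one_mem' := by simp
  mul_mem' := by
    rintro g h ⟨hg, hg'⟩ ⟨hh, hh'⟩
    refine ⟨?_, by simp [hg', hh']⟩
    calc _ = (h : Matrix n n ℝ).transpose *
          ((g : Matrix n n ℝ).transpose * b * (g : Matrix n n ℝ)) * (h : Matrix n n ℝ) := by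
            simp [Matrix.transpose_mul, Matrix.mul_assoc]
      _ = b := by rw [hg, hh]
  inv_mem' := by
    rintro g ⟨hg, hg'⟩
    have h1 : (g : Matrix n n ℝ) * ((g⁻¹ : GL n ℝ) : Matrix n n ℝ) = 1 := by
      rw [← Units.val_mul, mul_inv_cancel, Units.val_one]
    have h2 : ((g⁻¹ : GL n ℝ) : Matrix n n ℝ).transpose * (g : Matrix n n ℝ).transpose = 1 := by
      rw [← Matrix.transpose_mul, h1, Matrix.transpose_one]
    refine ⟨?_, ?_⟩
    · calc _ = ((g⁻¹ : GL n ℝ) : Matrix n n ℝ).transpose *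
            ((g : Matrix n n ℝ).transpose * b * (g : Matrix n n ℝ)) *
              ((g⁻¹ : GL n ℝ) : Matrix n n ℝ) := by rw [hg]
        _ = (((g⁻¹ : GL n ℝ) : Matrix n n ℝ).transpose * (g : Matrix n n ℝ).transpose) * b *
              ((g : Matrix n n ℝ) * ((g⁻¹ : GL n ℝ) : Matrix n n ℝ)) := by
            simp only [Matrix.mul_assoc]
        _ = b := by rw [h1, h2]; simp
    · have := congrArg Matrix.det h1
      simp_all

/-- The connected component of the identity of the special pseudo-orthogonal group. -/
def specialOrthogonalO {n : Type} [Fintype n] [DecidableEq n] (b : Matrix n n ℝ) :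
    Subgroup (GL n ℝ) :=
  (Subgroup.connectedComponentOfOne (specialOrthogonal b)).map (specialOrthogonal b).subtype

/-- The connected Poincaré group `ISO_o(3,1)`, as the group of affine matrices with linear part in
`SO_o(3,1)`. -/
def poincare : Subgroup (GL Idx ℝ) where
  carrier := {g | ∃ L ∈ specialOrthogonalO eta, ∃ v : Matrix (Fin 4) (Fin 1) ℝ,
    (g : Mat) = Matrix.fromBlocks (L : Matrix (Fin 4) (Fin 4) ℝ) v 0 1}
  one_mem' := ⟨1, one_mem _, 0, by simp⟩
  mul_mem' := by
    rintro g h ⟨L, hL, v, hg⟩ ⟨L', hL', v', hh⟩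
    exact ⟨L * L', mul_mem hL hL', (L : Matrix (Fin 4) (Fin 4) ℝ) * v' + v, by
      simp [hg, hh, Matrix.fromBlocks_multiply]⟩
  inv_mem' := by
    rintro g ⟨L, hL, v, hg⟩
    have h1 : (L : Matrix (Fin 4) (Fin 4) ℝ) * ((L⁻¹ : GL (Fin 4) ℝ) : Matrix _ _ ℝ) = 1 := by
      rw [← Units.val_mul, mul_inv_cancel, Units.val_one]
    refine ⟨L⁻¹, inv_mem hL, -(((L⁻¹ : GL (Fin 4) ℝ) : Matrix (Fin 4) (Fin 4) ℝ) * v), ?_⟩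
    refine Units.inv_eq_of_mul_eq_one_right ?_
    rw [hg, Matrix.fromBlocks_multiply, h1]
    simp [← Matrix.mul_assoc, ← Matrix.fromBlocks_one]

/-- The symmetry group of the model: `SO_o(4,1)`, `ISO_o(3,1)` or `SO_o(3,2)`. -/
def G : Model → Subgroup (GL Idx ℝ)
  | .deSitter => specialOrthogonalO (ambient .deSitter)
  | .minkowski => poincare
  | .antiDeSitter => specialOrthogonalO (ambient .antiDeSitter)

/-- The block-diagonal embedding `L ↦ diag(L, 1)`. -/
def blockEmbedding : GL (Fin 4) ℝ →* GL Idx ℝ :=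
  Units.map
    { toFun := fun L => Matrix.fromBlocks L 0 0 1
      map_one' := by simp
      map_mul' := by intro L L'; simp [Matrix.fromBlocks_multiply] }

/-- The Lorentz group `SO_o(3,1)` as a subgroup of the symmetry group of the model. -/
def H (k : Model) : Subgroup (G k) :=
  ((specialOrthogonalO eta).map blockEmbedding).subgroupOf (G k)

/-- The matrix of an element of `G`. -/
def mat {k : Model} (g : G k) : Mat := ((g : GL Idx ℝ) : Mat)

/-! ### Lie algebras and the reductive splitting -/

/-- The Lie algebra `𝔤` of `G`: `so(4,1)`, `iso(3,1)` or `so(3,2)`. -/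
def lieG : Model → Submodule ℝ Mat
  | .deSitter => skewAdjointMatricesSubmodule (ambient .deSitter)
  | .minkowski =>
    { carrier := {X | ∃ a ∈ skewAdjointMatricesSubmodule eta, ∃ v, X = Matrix.fromBlocks a v 0 0}
      zero_mem' := ⟨0, zero_mem _, 0, by simp⟩
      add_mem' := by
        rintro _ _ ⟨a, ha, v, rfl⟩ ⟨a', ha', v', rfl⟩
        exact ⟨a + a', add_mem ha ha', v + v', by simp [Matrix.fromBlocks_add]⟩
      smul_mem' := by
        rintro c _ ⟨a, ha, v, rfl⟩
        exact ⟨c • a, Submodule.smul_mem _ c ha, c • v, by simp [Matrix.fromBlocks_smul]⟩ }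
  | .antiDeSitter => skewAdjointMatricesSubmodule (ambient .antiDeSitter)

/-- The block-diagonal projection `(a, v; w, d) ↦ (a, 0; 0, 0)`. -/
def blockPart : Mat →ₗ[ℝ] Mat where
  toFun X := Matrix.fromBlocks X.toBlocks₁₁ 0 0 0
  map_add' X Y := by ext (i | i) (j | j) <;> simp [Matrix.toBlocks₁₁]
  map_smul' c X := by ext (i | i) (j | j) <;> simp [Matrix.toBlocks₁₁]

/-- The Lie algebra `𝔥` of `H`: the elements of `𝔤` of the form `(a, 0; 0, 0)`. -/
def lieH (k : Model) : Submodule ℝ Mat := lieG k ⊓ LinearMap.ker (blockPart - LinearMap.id)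

/-- The complement `𝔭` of `𝔥` in `𝔤`: the elements of `𝔤` of the form `(0, v; w, 0)`. -/
def lieP (k : Model) : Submodule ℝ Mat := lieG k ⊓ LinearMap.ker blockPart

lemma blockPart_mem {k : Model} {X : Mat} (hX : X ∈ lieG k) : blockPart X ∈ lieG k := by
  have key : ∀ s : ℝ, ∀ b : Mat, b = Matrix.fromBlocks eta 0 0 (Matrix.diagonal fun _ => s) →
      X ∈ skewAdjointMatricesSubmodule b → blockPart X ∈ skewAdjointMatricesSubmodule b := by
    rintro s b rfl h
    rw [mem_skewAdjointMatricesSubmodule] at h ⊢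
    unfold Matrix.IsSkewAdjoint Matrix.IsAdjointPair at h ⊢
    rw [← Matrix.fromBlocks_toBlocks X] at h
    simp only [Matrix.fromBlocks_transpose, Matrix.fromBlocks_multiply, Matrix.fromBlocks_neg,
      Matrix.fromBlocks_inj] at h
    change (Matrix.fromBlocks X.toBlocks₁₁ 0 0 0).transpose * _ =
      _ * -(Matrix.fromBlocks X.toBlocks₁₁ 0 0 0)
    simp only [Matrix.fromBlocks_transpose, Matrix.fromBlocks_multiply, Matrix.fromBlocks_neg,
      Matrix.fromBlocks_inj]
    refine ⟨by simpa using h.1, ?_, ?_, ?_⟩ <;> simp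
  cases k with
  | deSitter => exact key _ _ rfl hX
  | minkowski =>
    obtain ⟨a, ha, v, rfl⟩ := hX
    exact ⟨a, ha, 0, by simp [blockPart]⟩
  | antiDeSitter => exact key _ _ rfl hX

lemma blockPart_blockPart (X : Mat) : blockPart (blockPart X) = blockPart X := by
  simp [blockPart]

/-- The projection `𝔤 = 𝔥 ⊕ 𝔭 → 𝔥`. -/
def projH (k : Model) : lieG k →ₗ[ℝ] lieH k :=
  (blockPart ∘ₗ (lieG k).subtype).codRestrict (lieH k) fun X =>
    ⟨blockPart_mem X.2, by simp [blockPart_blockPart]⟩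

/-- The projection `𝔤 = 𝔥 ⊕ 𝔭 → 𝔭`. -/
def projP (k : Model) : lieG k →ₗ[ℝ] lieP k :=
  ((LinearMap.id - blockPart) ∘ₗ (lieG k).subtype).codRestrict (lieP k) fun X =>
    ⟨sub_mem X.2 (blockPart_mem X.2), by simp [blockPart_blockPart]⟩

/-! ### Cartan geometries -/

section Cartan

variable {k : Model} {M P : Type*}
  [TopologicalSpace M] [ChartedSpace (EuclideanSpace ℝ (Fin 4)) M] [IsManifold (𝓡 4) ∞ M]
  [TopologicalSpace P] [ChartedSpace (EuclideanSpace ℝ (Fin 10)) P] [IsManifold (𝓡 10) ∞ P]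
  [MulAction (H k)ᵐᵒᵖ P]

variable (k) in
/-- `π : P → M` is a smooth principal right `H`-bundle. As `H` is an embedded submanifold of the
space of matrices, a map into `H` is smooth iff it is smooth as a matrix-valued map; smoothness
of the action `P × H → P` is expressed by composing it with smooth maps into `P` and `H`.
The local trivialization over `U` given by `s` and `τ` is `U × H ≃ π⁻¹ U`, `(x, h) ↦ s(x) h`,
with inverse `p ↦ (π p, τ p)`. -/
structure IsPrincipalBundle (π : P → M) : Prop where
  smooth_proj : ContMDiff (𝓡 10) (𝓡 4) ∞ π
  smooth_action : ∀ (V : Type) [NormedAddCommGroup V] [NormedSpace ℝ V] (S : Set V)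
    (f : V → P) (h : V → H k), ContMDiffOn 𝓘(ℝ, V) (𝓡 10) ∞ f S →
    ContDiffOn ℝ ∞ (fun x => ent (mat (h x : G k))) S →
    ContMDiffOn 𝓘(ℝ, V) (𝓡 10) ∞ (fun x => f x <• h x) S
  free : ∀ (p : P) (h : H k), p <• h = p → h = 1
  fibre : ∀ p q : P, π p = π q ↔ ∃ h : H k, q = p <• h
  locally_trivial : ∀ x : M, ∃ U : Set M, IsOpen U ∧ x ∈ U ∧ ∃ (s : M → P) (τ : P → H k),
    ContMDiffOn (𝓡 4) (𝓡 10) ∞ s U ∧ (∀ y ∈ U, π (s y) = y) ∧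
    ContMDiffOn (𝓡 10) 𝓘(ℝ, Idx → Idx → ℝ) ∞ (fun p => ent (mat (τ p : G k))) (π ⁻¹' U) ∧
    ∀ p ∈ π ⁻¹' U, p = s (π p) <• τ p

variable (k M P) in
/-- A Cartan geometry `(π : P → M, A)` modeled on `(G, H)`. -/
structure CartanGeometry where
  /-- The bundle projection. -/
  π : P → M
  principal : IsPrincipalBundle k π
  /-- The Cartan connection, a linear isomorphism `T_p P → 𝔤` for each `p`. -/
  A : ∀ p : P, TangentSpace (𝓡 10) p ≃ₗ[ℝ] lieG k
  smooth_A : ContMDiff (𝓡 10).tangent 𝓘(ℝ, Idx → Idx → ℝ) ∞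
    (fun v : TangentBundle (𝓡 10) P => ent (A v.proj v.snd))
  /-- `R_h^* A = Ad(h⁻¹) ∘ A`. -/
  equivariant : ∀ (h : H k) (p : P) (v : TangentSpace (𝓡 10) p),
    (A (p <• h) (mfderiv (𝓡 10) (𝓡 10) (fun q : P => q <• h) p v) : Mat) =
      mat ((h : G k)⁻¹) * (A p v : Mat) * mat (h : G k)
  /-- `A` pulls back to the left-invariant Maurer–Cartan form `h⁻¹ dh` along `h ↦ p h`. -/
  maurerCartan : ∀ (p : P) (h : ℝ → H k), ContDiff ℝ ∞ (fun t => ent (mat (h t : G k))) →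
    ∀ t : ℝ, (A (p <• h t) (mfderiv 𝓘(ℝ, ℝ) (𝓡 10) (fun s => p <• h s) t (1 : ℝ)) : Mat) =
      mat ((h t : G k)⁻¹) * Matrix.of (deriv (fun s => ent (mat (h s : G k))) t)

/-! ### Affine connections and their geodesics -/

/-- The velocity of a path `[0,1] → M` (one-sided at the end points). -/
def velocity (γ : ℝ → M) (t : ℝ) : TangentSpace (𝓡 4) (γ t) :=
  mfderivWithin 𝓘(ℝ, ℝ) (𝓡 4) γ (Icc 0 1) t (1 : ℝ)

/-- The covariant derivative along `γ` of a vector field `V` along `γ`, for a connection `∇` on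
`TM` (`∇ Y x v` is `∇_v Y` at `x`). In the chart at `γ t`, with coordinate fields `∂_j` and
`V = ∑ V^j ∂_j`, it is `∑ (dV^j/dt) ∂_j + ∑ V^j ∇_{γ'} ∂_j`. -/
def covDerivAlong
    (nabla : (∀ x : M, TangentSpace (𝓡 4) x) → ∀ x : M, TangentSpace (𝓡 4) x →
      TangentSpace (𝓡 4) x)
    (γ : ℝ → M) (V : ∀ t : ℝ, TangentSpace (𝓡 4) (γ t)) (t : ℝ) : TangentSpace (𝓡 4) (γ t) :=
  let T := trivializationAt (EuclideanSpace ℝ (Fin 4)) (TangentSpace (𝓡 4) : M → Type _) (γ t)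
  let comp : ℝ → EuclideanSpace ℝ (Fin 4) := fun s => (T ⟨γ s, V s⟩).2
  T.symm (γ t) (derivWithin comp (Icc 0 1) t) +
    nabla (fun y => T.symm y (comp t)) (γ t) (velocity γ t)

/-- A smooth path `γ : [0,1] → M` is a geodesic of `∇` if `∇_{γ'} γ' = 0`. -/
def IsGeodesic
    (nabla : (∀ x : M, TangentSpace (𝓡 4) x) → ∀ x : M, TangentSpace (𝓡 4) x →
      TangentSpace (𝓡 4) x) (γ : ℝ → M) : Prop :=
  ContMDiffOn 𝓘(ℝ, ℝ) (𝓡 4) ∞ γ (Icc 0 1) ∧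
    ∀ t ∈ Icc (0 : ℝ) 1, covDerivAlong nabla γ (velocity γ) t = 0

namespace CartanGeometry

variable (X : CartanGeometry k M P)

/-- The `𝔥`-part of the Cartan connection, an Ehresmann connection on `P`. -/
def omega (p : P) : TangentSpace (𝓡 10) p →ₗ[ℝ] lieH k := projH k ∘ₗ (X.A p).toLinearMap

/-- The `𝔭`-part of the Cartan connection. -/
def soldering (p : P) : TangentSpace (𝓡 10) p →ₗ[ℝ] lieP k := projP k ∘ₗ (X.A p).toLinearMap

/-- The `ω`-horizontal lift of `v ∈ T_{π p} M` to `p`: the unique `w ∈ T_p P` that projects to `v`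
and satisfies `ω(w) = 0`. -/
def horizontalLift (p : P) (v : TangentSpace (𝓡 4) (X.π p)) : TangentSpace (𝓡 10) p :=
  Classical.epsilon fun w : TangentSpace (𝓡 10) p =>
    mfderiv (𝓡 10) (𝓡 4) X.π p w = v ∧ X.omega p w = 0

/-- The coframe isomorphism `T_{π p} M ≃ 𝔭`, `v ↦ e(w)` for any lift `w` of `v`; it is the
isomorphism `TM ≃ P ×_H 𝔭`, `v ↦ [p, e(w)]`, read in the frame `p`. -/
def coframe (p : P) (v : TangentSpace (𝓡 4) (X.π p)) : lieP k :=
  X.soldering p (X.horizontalLift p v)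

/-- The connection on `TM ≃ P ×_H 𝔭` induced by `ω`: a vector field `Y` is an equivariant function
`f : P → 𝔭`, `f(q) = coframe_q (Y(π q))`, and `∇_v Y` is the vector whose coframe components at a
point `p` over `x` are the derivative of `f` along the horizontal lift of `v` to `p`.
By equivariance the choice of `p` is immaterial. -/
def inducedConnection (Y : ∀ x : M, TangentSpace (𝓡 4) x) (x : M) (v : TangentSpace (𝓡 4) x) :
    TangentSpace (𝓡 4) x :=
  Classical.epsilon fun u : TangentSpace (𝓡 4) x => ∃ (p : P) (hp : X.π p = x),
    ent (X.coframe p (hp ▸ u)) =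
      mfderiv (𝓡 10) 𝓘(ℝ, Idx → Idx → ℝ) (fun q : P => ent (X.coframe q (Y (X.π q)))) p
        (X.horizontalLift p (hp ▸ v))

/-- `σ : [0,1] → G/H` is a development of the path `γ : [0,1] → M`: for a smooth lift `C` of `γ`
to `P`, `σ(t) = g(t) H` where `g⁻¹ g' = A(C')`. The initial value `g(0)` is arbitrary. -/
def IsDevelopment (γ : ℝ → M) (σ : ℝ → G k ⧸ H k) : Prop :=
  ∃ C : ℝ → P, ContMDiffOn 𝓘(ℝ, ℝ) (𝓡 10) ∞ C (Icc 0 1) ∧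
    (∀ t ∈ Icc (0 : ℝ) 1, X.π (C t) = γ t) ∧
    ∃ g : ℝ → G k,
      (∀ t ∈ Icc (0 : ℝ) 1, HasDerivWithinAt (fun s => ent (mat (g s)))
        (ent (mat (g t) * X.A (C t) (mfderivWithin 𝓘(ℝ, ℝ) (𝓡 10) C (Icc 0 1) t (1 : ℝ))))
        (Icc 0 1) t) ∧
      ∀ t ∈ Icc (0 : ℝ) 1, σ t = (g t : G k ⧸ H k)

end CartanGeometry

end Cartan

/-! ### Geodesics of the model space -/

/-- `ℝ⁵`. -/
abbrev Vec : Type := Idx → ℝ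

/-- The ambient bilinear form. -/
def form (k : Model) (v w : Vec) : ℝ := dotProduct v ((ambient k).mulVec w)

/-- The base point `z = (0,0,0,0,1)`, whose stabilizer in `G` is `H`. -/
def basePoint : Vec := Sum.elim 0 1

/-- The model spacetime `Z ≅ G/H`: the hyperquadric `⟨x,x⟩ = ±1` for (anti-)de Sitter,
the affine hyperplane `x₅ = 1` for Minkowski. -/
def space : Model → Set Vec
  | .deSitter => {x | form .deSitter x x = 1}
  | .minkowski => {x | x (Sum.inr 0) = 1}
  | .antiDeSitter => {x | form .antiDeSitter x x = -1}

lemma mat_mulVec_basePoint {k : Model} (h : G k) (hh : h ∈ H k) :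
    (mat h).mulVec basePoint = basePoint := by
  obtain ⟨L, -, hL⟩ := hh
  have : mat h = Matrix.fromBlocks (L : Matrix (Fin 4) (Fin 4) ℝ) 0 0 1 := by
    rw [mat, ← Subgroup.coe_subtype, ← hL]; rfl
  rw [this, basePoint, Matrix.fromBlocks_mulVec]
  simp

/-- The `G`-equivariant identification `G/H → Z ⊂ ℝ⁵`, `gH ↦ g z`. -/
def orbit {k : Model} : G k ⧸ H k → Vec :=
  Quotient.lift (fun g : G k => (mat g).mulVec basePoint) (by
    intro a b hab
    have h := mat_mulVec_basePoint _ (QuotientGroup.leftRel_apply.mp hab)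
    have h2 : mat b = mat a * mat (a⁻¹ * b) := by
      simp [mat]
    change (mat a).mulVec basePoint = (mat b).mulVec basePoint
    rw [h2, ← Matrix.mulVec_mulVec, h])

/-- The pull-back by a map `φ` of the ambient form: `g_u(v, w) = ⟨dφ_u v, dφ_u w⟩`. -/
def pullbackMetric (k : Model) (φ : (Fin 4 → ℝ) → Vec) (u v w : Fin 4 → ℝ) : ℝ :=
  form k (fderiv ℝ φ u v) (fderiv ℝ φ u w)

/-- A smooth path `σ : [0,1] → G/H ≅ Z` is a geodesic of the `G`-invariant metric `g` on the
symmetric space, i.e. of its Levi-Civita connection: for every local parametrization `φ` of `Z` and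
coordinates `x(t)` of the path, it satisfies the geodesic equation
`g(x'', w) + Γ(x', x'; w) = 0` for all `w`, where `Γ(v, v; w) = D_v g(v, w) - (1/2) D_w g(v, v)` is
the Christoffel symbol of the first kind. -/
def IsModelGeodesic (k : Model) (σ : ℝ → G k ⧸ H k) : Prop :=
  ContDiffOn ℝ ∞ (fun t => orbit (σ t)) (Icc 0 1) ∧
  ∀ t ∈ Icc (0 : ℝ) 1, ∀ (φ : (Fin 4 → ℝ) → Vec) (x : ℝ → Fin 4 → ℝ),
    ContDiffAt ℝ ∞ φ (x t) → Function.Injective (fderiv ℝ φ (x t)) →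
    (∀ᶠ u in 𝓝 (x t), φ u ∈ space k) →
    ContDiffWithinAt ℝ ∞ x (Icc 0 1) t →
    (∀ᶠ s in 𝓝[Icc 0 1] t, φ (x s) = orbit (σ s)) →
    let v := derivWithin x (Icc 0 1) t
    let a := derivWithin (derivWithin x (Icc 0 1)) (Icc 0 1) t
    ∀ w : Fin 4 → ℝ,
      pullbackMetric k φ (x t) a w +
        (fderiv ℝ (fun u => pullbackMetric k φ u v w) (x t) v -
          (1 / 2) * fderiv ℝ (fun u => pullbackMetric k φ u v v) (x t) w) = 0

end SpacetimeCartan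

end

noncomputable section

set_option linter.unusedSectionVars false

namespace SpacetimeCartan

/-! ### Pseudo-orthogonal one-parameter groups -/

section Exp

open NormedSpace

attribute [local instance] Matrix.linftyOpNormedRing Matrix.linftyOpNormedAlgebra

variable {n : Type} [Fintype n] [DecidableEq n]

/-! Fix a lift `C` of `γ` and put `a = A(C')`, a path in `𝔤` with `𝔥`-part `ω` and `𝔭`-part `e`.
Both sides of the equivalence say that `K = e' + [ω, e]` vanishes on `[0,1]`.

On `M`, the components of `γ'` in the frame `C` are exactly `e`. A vector field is an equivariant
function `f : P → 𝔭`. Its derivative along `C'` splits into a horizontal part, which is by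
definition the coframe of `∇_{γ'} Y`, and a vertical part, which equivariance forces to be `-[ω, f]`
(`dframeFun_vertical`). Hence `K` is the coframe of `∇_{γ'} γ'` (`hasDerivWithinAt_cof_velocity`).
The coframe is injective and linear, so one vanishes exactly when the other does.

On the model, embed `G/H` in `ℝ⁵` by `y = g z`, where `z` is the base point and `g' = g a`. Since
`𝔥` kills `z`, `y' = g e z` and `y'' = g (e² + K) z`. The vector `e² z` is a multiple of `z`
carrying the factor `sign`: it is normal to the hyperquadric, and zero in the affine case
(`mul_add_mulVec_basePoint`, `sign_mul_form_fderiv`). The geodesic equation in a parametrization is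
the vanishing of the tangential part of `y''` (`geodesic_expression_eq`), which is `g K z`, and `v ↦
v z` is injective on `𝔭`. Thus `σ` is a geodesic iff `K = 0` (`isModelGeodesic_iff`).

The geometric input on `P` is that `ker dπ = ker e` (`dproj_eq_zero_iff`). One inclusion uses
one-parameter subgroups of `H`, and the other is a dimension count. -/

lemma exp_smul_add_mul (a : Matrix n n ℝ) (s t : ℝ) :
    exp ((s + t) • a) = exp (s • a) * exp (t • a) := by
  rw [add_smul]
  exact Matrix.exp_add_of_commute _ _ (((Commute.refl a).smul_left s).smul_right t)

lemma hasDerivAt_matrix_exp (a : Matrix n n ℝ) (t : ℝ) (i j : n) :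
    HasDerivAt (fun s : ℝ => exp (s • a) i j) ((exp (t • a) * a) i j) t := by
  have h := hasDerivAt_exp_smul_const (𝕂 := ℝ) a t
  let l : Matrix n n ℝ →ₗ[ℝ] ℝ :=
    { toFun := fun X => X i j, map_add' := fun _ _ => rfl, map_smul' := fun _ _ => rfl }
  exact (l.toContinuousLinearMap.hasFDerivAt (x := exp (t • a))).comp_hasDerivAt t h

lemma contDiff_matrix_exp (a : Matrix n n ℝ) (i j : n) :
    ContDiff ℝ ∞ (fun s : ℝ => exp (s • a) i j) := by
  have h : ContDiff ℝ ∞ (fun s : ℝ => exp (s • a)) := by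
    refine contDiff_iff_contDiffAt.2 fun t => ?_
    have h1 : ContDiffAt ℝ ∞ (exp : Matrix n n ℝ → Matrix n n ℝ) (t • a) :=
      (exp_analytic (𝕂 := ℝ) (t • a)).contDiffAt
    exact h1.comp t (contDiff_id.smul contDiff_const).contDiffAt
  let l : Matrix n n ℝ →ₗ[ℝ] ℝ :=
    { toFun := fun X => X i j, map_add' := fun _ _ => rfl, map_smul' := fun _ _ => rfl }
  exact l.toContinuousLinearMap.contDiff.comp h

end Exp

section OneParameter

open NormedSpace

variable {n : Type} [Fintype n] [DecidableEq n]

/-- Skewness says that `aᵀ` is conjugate by `b` to `-a`, so `(exp a)ᵀ` is conjugate by `b` to `(exp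
a)⁻¹`. -/
lemma exp_transpose_mul_mul_exp {a b : Matrix n n ℝ} (hb : b * b = 1)
    (ha : a.transpose * b = -(b * a)) : (exp a).transpose * b * exp a = b := by
  have hu : IsUnit b := ⟨⟨b, b, hb, hb⟩, rfl⟩
  have hinv : b⁻¹ = b := Matrix.inv_eq_left_inv hb
  have h1 : a.transpose = b * (-a) * b⁻¹ := by
    rw [hinv, mul_neg, ← ha, mul_assoc, hb, mul_one]
  rw [← Matrix.exp_transpose, h1, Matrix.exp_conj _ _ hu, hinv, mul_assoc _ b b, hb, mul_one,
    mul_assoc, Matrix.exp_neg]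
  rw [Matrix.nonsing_inv_mul, mul_one]
  exact (Matrix.isUnit_iff_isUnit_det _).1 (Matrix.isUnit_exp a)

/-- Preserving `b` only gives determinant `±1`; the sign is settled because `exp a` is the square of
`exp (a / 2)`. -/
lemma det_exp_of_skew {a b : Matrix n n ℝ} (hb : b * b = 1)
    (ha : a.transpose * b = -(b * a)) : (exp a).det = 1 := by
  have key : ∀ {c : Matrix n n ℝ}, c.transpose * b = -(b * c) → (exp c).det ^ 2 = 1 := by
    intro c hc
    have h := congrArg Matrix.det (exp_transpose_mul_mul_exp hb hc)
    rw [Matrix.det_mul, Matrix.det_mul, Matrix.det_transpose] at h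
    have hb' : b.det ≠ 0 := by
      intro h0
      have := congrArg Matrix.det hb
      simp [h0] at this
    have : b.det * ((exp c).det ^ 2 - 1) = 0 := by linear_combination h
    rcases mul_eq_zero.1 this with h | h
    · exact absurd h hb'
    · linarith
  have h2 : ((1 / 2 : ℝ) • a).transpose * b = -(b * ((1 / 2 : ℝ) • a)) := by
    rw [Matrix.transpose_smul, Matrix.smul_mul, ha, Matrix.mul_smul, smul_neg]
  have h3 : exp a = exp ((1 / 2 : ℝ) • a) * exp ((1 / 2 : ℝ) • a) := by
    rw [← exp_smul_add_mul]; norm_num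
  rw [h3, Matrix.det_mul, ← sq, key h2]

/-- The one-parameter group `t ↦ exp (t a)` in the general linear group. -/
def expUnit (a : Matrix n n ℝ) (t : ℝ) : GL n ℝ where
  val := exp (t • a)
  inv := exp ((-t) • a)
  val_inv := by rw [← exp_smul_add_mul]; simp
  inv_val := by rw [← exp_smul_add_mul]; simp

lemma expUnit_zero (a : Matrix n n ℝ) : expUnit a 0 = 1 := by
  ext1; simp [expUnit]

lemma continuous_matrix_exp_smul (a : Matrix n n ℝ) : Continuous fun t : ℝ => exp (t • a) :=
  continuous_matrix fun i j => (contDiff_matrix_exp a i j).continuous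

lemma expUnit_mem {a b : Matrix n n ℝ} (hb : b * b = 1) (ha : a.transpose * b = -(b * a)) (t : ℝ) :
    expUnit a t ∈ specialOrthogonalO b := by
  have hs : ∀ s : ℝ, (s • a).transpose * b = -(b * (s • a)) := fun s => by
    rw [Matrix.transpose_smul, Matrix.smul_mul, ha, Matrix.mul_smul, smul_neg]
  let c : ℝ → specialOrthogonal b := fun s =>
    ⟨expUnit a s, exp_transpose_mul_mul_exp hb (hs s), det_exp_of_skew hb (hs s)⟩
  have hc : Continuous c := by
    refine Continuous.subtype_mk (Units.continuous_iff.2 ⟨continuous_matrix_exp_smul a, ?_⟩) _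
    exact (continuous_matrix_exp_smul a).comp continuous_neg
  have h0 : c 0 = 1 := Subtype.ext (expUnit_zero a)
  refine ⟨c t, ?_, rfl⟩
  -- The one-parameter group is a connected subset through `1`, so it stays in the identity
  -- component.
  have := (isPreconnected_range hc).subset_connectedComponent (mem_range_self 0)
  rw [h0] at this
  exact this (mem_range_self t)

end OneParameter

/-! ### The groups `G` and `H` -/

lemma eta_mul_eta : eta * eta = 1 := by
  rw [eta, Matrix.diagonal_mul_diagonal, ← Matrix.diagonal_one]
  congr 1; ext i; fin_cases i <;> simp

lemma specialOrthogonal_of_mem_specialOrthogonalO {n : Type} [Fintype n] [DecidableEq n]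
    {b : Matrix n n ℝ} {g : GL n ℝ} (hg : g ∈ specialOrthogonalO b) : g ∈ specialOrthogonal b := by
  obtain ⟨g, -, rfl⟩ := hg
  exact g.2

lemma blockEmbedding_coe (L : GL (Fin 4) ℝ) :
    ((blockEmbedding L : GL Idx ℝ) : Mat) =
      Matrix.fromBlocks (L : Matrix (Fin 4) (Fin 4) ℝ) 0 0 1 := rfl

lemma continuous_blockEmbedding : Continuous blockEmbedding := by
  refine Continuous.units_map _ ?_
  exact Continuous.matrix_fromBlocks continuous_id continuous_const continuous_const
    continuous_const

lemma blockEmbedding_mem_specialOrthogonal (k : Model) {L : GL (Fin 4) ℝ}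
    (hL : L ∈ specialOrthogonal eta) : blockEmbedding L ∈ specialOrthogonal (ambient k) := by
  refine ⟨?_, ?_⟩
  · rw [blockEmbedding_coe, ambient, Matrix.fromBlocks_transpose, Matrix.fromBlocks_multiply,
      Matrix.fromBlocks_multiply]
    simp [hL.1]
  · rw [blockEmbedding_coe, Matrix.det_fromBlocks_zero₂₁]
    simp [hL.2]

lemma blockEmbedding_mem_specialOrthogonalO (k : Model) {L : GL (Fin 4) ℝ}
    (hL : L ∈ specialOrthogonalO eta) : blockEmbedding L ∈ specialOrthogonalO (ambient k) := by
  obtain ⟨L, hL, rfl⟩ := hL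
  let f : specialOrthogonal eta → specialOrthogonal (ambient k) := fun L =>
    ⟨blockEmbedding L, blockEmbedding_mem_specialOrthogonal k L.2⟩
  have hf : Continuous f :=
    Continuous.subtype_mk (continuous_blockEmbedding.comp continuous_subtype_val) _
  have h1 : f 1 = 1 := Subtype.ext (map_one blockEmbedding)
  refine ⟨f L, ?_, rfl⟩
  have := hf.image_connectedComponent_subset 1 ⟨L, hL, rfl⟩
  rwa [h1] at this

lemma blockEmbedding_mem_G (k : Model) {L : GL (Fin 4) ℝ}
    (hL : L ∈ specialOrthogonalO eta) : blockEmbedding L ∈ G k := by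
  cases k with
  | deSitter => exact blockEmbedding_mem_specialOrthogonalO _ hL
  | minkowski => exact ⟨L, hL, 0, rfl⟩
  | antiDeSitter => exact blockEmbedding_mem_specialOrthogonalO _ hL

variable {k : Model}

lemma mat_mul (g h : G k) : mat (g * h) = mat g * mat h := rfl

lemma mat_one : mat (1 : G k) = 1 := rfl

lemma mat_inv_mul (g : G k) : mat g⁻¹ * mat g = 1 := by
  rw [← mat_mul, inv_mul_cancel, mat_one]

lemma mat_mul_inv (g : G k) : mat g * mat g⁻¹ = 1 := by
  rw [← mat_mul, mul_inv_cancel, mat_one]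

lemma mat_injective : Function.Injective (mat : G k → Mat) := fun _ _ h =>
  Subtype.ext (Units.ext h)

lemma exists_mat_eq_fromBlocks (h : H k) : ∃ L : Matrix (Fin 4) (Fin 4) ℝ,
    L.transpose * eta * L = eta ∧ mat (h : G k) = Matrix.fromBlocks L 0 0 1 := by
  obtain ⟨L, hL, hh⟩ := h.2
  refine ⟨L, (specialOrthogonal_of_mem_specialOrthogonalO hL).1, ?_⟩
  rw [mat, ← Subgroup.coe_subtype, ← hh]; rfl

/-- The Euclidean reflection `diag(-1, 1, 1, 1, 1)`. -/
def reflection : Mat := Matrix.fromBlocks eta 0 0 1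

/-- The inverse of an element of `H` is a linear function of its entries. -/
lemma mat_inv_eq (h : H k) :
    mat ((h : G k)⁻¹) = reflection * (mat (h : G k)).transpose * reflection := by
  obtain ⟨L, hL, hm⟩ := exists_mat_eq_fromBlocks h
  have h1 : (reflection * (mat (h : G k)).transpose * reflection) * mat (h : G k) = 1 := by
    rw [hm, reflection, Matrix.fromBlocks_transpose, Matrix.fromBlocks_multiply,
      Matrix.fromBlocks_multiply, Matrix.fromBlocks_multiply]
    have : eta * L.transpose * eta * L = 1 := by
      rw [mul_assoc eta, mul_assoc, hL, eta_mul_eta]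
    simp [this]
  calc mat ((h : G k)⁻¹) = (reflection * (mat (h : G k)).transpose * reflection) *
        (mat (h : G k) * mat ((h : G k)⁻¹)) := by rw [← mul_assoc, h1, one_mul]
    _ = _ := by rw [mat_mul_inv, mul_one]

/-! ### The Lie algebras -/

lemma mem_skewAdjoint_iff {n : Type} [Fintype n] [DecidableEq n] {b a : Matrix n n ℝ} :
    a ∈ skewAdjointMatricesSubmodule b ↔ a.transpose * b = -(b * a) := by
  rw [mem_skewAdjointMatricesSubmodule, Matrix.IsSkewAdjoint, Matrix.IsAdjointPair, mul_neg]

/-- The matrix of `𝔭` with first column block `v`. -/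
def transvection (k : Model) (v : Matrix (Fin 4) (Fin 1) ℝ) : Mat :=
  Matrix.fromBlocks 0 v (-(k.sign • (v.transpose * eta))) 0

/-- As `s² = 1`, the upper right block determines the lower left one; the lower right block is a
skew `1 × 1` matrix, hence zero. -/
lemma mem_skewAdjoint_fromBlocks_iff {s : ℝ} (hs : s * s = 1) {X : Mat} :
    X ∈ skewAdjointMatricesSubmodule
        (Matrix.fromBlocks eta 0 0 (Matrix.diagonal fun _ => s) : Mat) ↔
      ∃ a v, a.transpose * eta = -(eta * a) ∧
        X = Matrix.fromBlocks a v (-(s • (v.transpose * eta))) 0 := by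
  have hd : (Matrix.diagonal fun _ => s : Matrix (Fin 1) (Fin 1) ℝ) = s • 1 := by
    ext i j; simp [Matrix.diagonal_apply, Matrix.one_apply]
  have hs0 : s ≠ 0 := by rintro rfl; simp at hs
  rw [mem_skewAdjoint_iff, hd]
  constructor
  · intro h
    rw [← Matrix.fromBlocks_toBlocks X] at h
    simp only [Matrix.fromBlocks_transpose, Matrix.fromBlocks_multiply, Matrix.fromBlocks_neg,
      Matrix.fromBlocks_inj] at h
    obtain ⟨h1, h2, h3, h4⟩ := h
    refine ⟨X.toBlocks₁₁, X.toBlocks₁₂, by simpa using h1, ?_⟩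
    conv_lhs => rw [← Matrix.fromBlocks_toBlocks X]
    simp only [Matrix.mul_zero, Matrix.zero_mul, zero_add, add_zero, Matrix.mul_smul,
      Matrix.smul_mul, Matrix.mul_one, Matrix.one_mul] at h3 h4
    congr 1
    · rw [h3, smul_neg, smul_smul, hs, one_smul, neg_neg]
    · ext i j
      have := congrFun (congrFun h4 i) j
      rw [Subsingleton.elim i j] at this ⊢
      simp only [Matrix.smul_apply, Matrix.transpose_apply, Matrix.neg_apply, smul_eq_mul] at this
      have h0 : s * X.toBlocks₂₂ j j = 0 := by linarith
      simpa [hs0] using h0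
  · rintro ⟨a, v, ha, rfl⟩
    simp only [Matrix.fromBlocks_transpose, Matrix.fromBlocks_multiply, Matrix.fromBlocks_neg,
      Matrix.fromBlocks_inj]
    have he : eta.transpose = eta := by simp [eta]
    refine ⟨by simpa using ha, ?_, ?_, by simp⟩
    · simp [Matrix.transpose_mul, he, smul_smul, hs]
    · simp [smul_smul, hs]

/-- One formula serves all three models: at `sign = 0` the lower row disappears, which is
`iso(3,1)`. Later arguments can then avoid splitting into cases. -/
lemma mem_lieG_iff {X : Mat} : X ∈ lieG k ↔
    ∃ a v, a.transpose * eta = -(eta * a) ∧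
      X = Matrix.fromBlocks a v (-(k.sign • (v.transpose * eta))) 0 := by
  cases k with
  | deSitter => exact mem_skewAdjoint_fromBlocks_iff (by simp [Model.sign])
  | minkowski =>
    constructor
    · rintro ⟨a, ha, v, rfl⟩
      exact ⟨a, v, mem_skewAdjoint_iff.1 ha, by simp [Model.sign]⟩
    · rintro ⟨a, v, ha, rfl⟩
      exact ⟨a, mem_skewAdjoint_iff.2 ha, v, by simp [Model.sign]⟩
  | antiDeSitter => exact mem_skewAdjoint_fromBlocks_iff (by simp [Model.sign])

lemma blockPart_fromBlocks (a : Matrix (Fin 4) (Fin 4) ℝ) (v : Matrix (Fin 4) (Fin 1) ℝ)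
    (w : Matrix (Fin 1) (Fin 4) ℝ) (d : Matrix (Fin 1) (Fin 1) ℝ) :
    blockPart (Matrix.fromBlocks a v w d) = Matrix.fromBlocks a 0 0 0 := by
  simp [blockPart]

lemma mem_lieH_iff {X : Mat} : X ∈ lieH k ↔
    ∃ a, a.transpose * eta = -(eta * a) ∧ X = Matrix.fromBlocks a 0 0 0 := by
  rw [lieH, Submodule.mem_inf, mem_lieG_iff, LinearMap.mem_ker, LinearMap.sub_apply,
    LinearMap.id_apply, sub_eq_zero]
  constructor
  · rintro ⟨⟨a, v, ha, rfl⟩, h⟩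
    exact ⟨a, ha, by rw [← h, blockPart_fromBlocks]⟩
  · rintro ⟨a, ha, rfl⟩
    exact ⟨⟨a, 0, ha, by simp⟩, by rw [blockPart_fromBlocks]⟩

lemma mem_lieP_iff {X : Mat} : X ∈ lieP k ↔ ∃ v, X = transvection k v := by
  rw [lieP, Submodule.mem_inf, mem_lieG_iff, LinearMap.mem_ker]
  constructor
  · rintro ⟨⟨a, v, ha, rfl⟩, h⟩
    rw [blockPart_fromBlocks, ← Matrix.fromBlocks_zero, Matrix.fromBlocks_inj] at h
    exact ⟨v, by rw [h.1, transvection]⟩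
  · rintro ⟨v, rfl⟩
    exact ⟨⟨0, v, by simp, rfl⟩, by rw [transvection, blockPart_fromBlocks, Matrix.fromBlocks_zero]⟩

lemma finrank_lieP_le : Module.finrank ℝ (lieP k) ≤ 4 := by
  let l : lieP k →ₗ[ℝ] Matrix (Fin 4) (Fin 1) ℝ :=
    { toFun := fun X => (X : Mat).toBlocks₁₂
      map_add' := fun _ _ => rfl
      map_smul' := fun _ _ => rfl }
  have hl : Function.Injective l := by
    rintro ⟨X, hX⟩ ⟨Y, hY⟩ h
    obtain ⟨v, rfl⟩ := mem_lieP_iff.1 hX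
    obtain ⟨w, rfl⟩ := mem_lieP_iff.1 hY
    have : v = w := h
    subst this; rfl
  have := LinearMap.finrank_le_finrank_of_injective hl
  simpa [Module.finrank_matrix] using this

/-- An element of `𝔥` generates a one-parameter subgroup of `H`. -/
lemma exists_oneParameter {X : Mat} (hX : X ∈ lieH k) : ∃ h : ℝ → H k, h 0 = 1 ∧
    ContDiff ℝ ∞ (fun t => ent (mat (h t : G k))) ∧
    HasDerivAt (fun t => ent (mat (h t : G k))) (ent X) 0 := by
  obtain ⟨a, ha, rfl⟩ := mem_lieH_iff.1 hX
  have hm : ∀ t, expUnit a t ∈ specialOrthogonalO eta := expUnit_mem eta_mul_eta ha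
  let h : ℝ → H k := fun t =>
    ⟨⟨blockEmbedding (expUnit a t), blockEmbedding_mem_G k (hm t)⟩, expUnit a t, hm t, rfl⟩
  have hh : ∀ t, mat (h t : G k) = Matrix.fromBlocks (NormedSpace.exp (t • a)) 0 0 1 := fun _ => rfl
  refine ⟨h, ?_, ?_, ?_⟩
  · refine Subtype.ext (mat_injective ?_)
    rw [hh]
    simp [mat_one]
  · simp_rw [hh]
    refine contDiff_pi.2 fun i => contDiff_pi.2 fun j => ?_
    rcases i with i | i <;> rcases j with j | j
    · exact contDiff_matrix_exp a i j
    all_goals exact contDiff_const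
  · simp_rw [hh]
    refine hasDerivAt_pi.2 fun i => hasDerivAt_pi.2 fun j => ?_
    rcases i with i | i <;> rcases j with j | j
    · have := hasDerivAt_matrix_exp a 0 i j
      simpa [ent] using this
    all_goals exact hasDerivAt_const _ _

end SpacetimeCartan

namespace SpacetimeCartan

/-! ### Adjoint action of `H` -/

section Adjoint

variable {k : Model}

/-- Elements of `H` are block diagonal, so the splitting `𝔤 = 𝔥 ⊕ 𝔭` is `Ad(H)`-invariant. -/
lemma blockPart_conj (h : H k) (Y : Mat) :
    blockPart (mat ((h : G k)⁻¹) * Y * mat (h : G k)) =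
      mat ((h : G k)⁻¹) * blockPart Y * mat (h : G k) := by
  obtain ⟨L, -, hL⟩ := exists_mat_eq_fromBlocks h
  obtain ⟨L', -, hL'⟩ := exists_mat_eq_fromBlocks h⁻¹
  rw [Subgroup.coe_inv] at hL'
  rw [hL, hL', ← Matrix.fromBlocks_toBlocks Y, Matrix.fromBlocks_multiply,
    Matrix.fromBlocks_multiply, blockPart_fromBlocks, blockPart_fromBlocks,
    Matrix.fromBlocks_multiply, Matrix.fromBlocks_multiply]
  simp

/-- The linear map `Y ↦ h⁻¹ Y h` on entries. -/
def conjEnt (h : H k) : (Idx → Idx → ℝ) →L[ℝ] (Idx → Idx → ℝ) :=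
  LinearMap.toContinuousLinearMap
    { toFun := fun Y => ent (mat ((h : G k)⁻¹) * Matrix.of Y * mat (h : G k))
      map_add' := fun Y Z => by
        rw [← Matrix.of_add_of, mul_add, add_mul]; rfl
      map_smul' := fun c Y => by
        rw [← Matrix.smul_of, Matrix.mul_smul, Matrix.smul_mul]; rfl }

lemma conjEnt_ent (h : H k) (Y : Mat) :
    conjEnt h (ent Y) = ent (mat ((h : G k)⁻¹) * Y * mat (h : G k)) := rfl

end Adjoint

/-! ### The principal bundle and the Cartan connection -/

section Bundle

variable {k : Model} {M P : Type*}
  [TopologicalSpace M] [ChartedSpace (EuclideanSpace ℝ (Fin 4)) M] [IsManifold (𝓡 4) ∞ M]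
  [TopologicalSpace P] [ChartedSpace (EuclideanSpace ℝ (Fin 10)) P] [IsManifold (𝓡 10) ∞ P]
  [MulAction (H k)ᵐᵒᵖ P]

namespace IsPrincipalBundle

lemma proj_right {π : P → M} (hπ : IsPrincipalBundle k π) (p : P) (h : H k) :
    π (p <• h) = π p := ((hπ.fibre p _).2 ⟨h, rfl⟩).symm

lemma contMDiff_right {π : P → M} (hπ : IsPrincipalBundle k π) (h : H k) :
    ContMDiff (𝓡 10) (𝓡 10) ∞ fun q : P => q <• h := by
  intro p
  -- Smoothness of the action is stated for maps out of normed spaces, so it is tested on an inverse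
  -- chart.
  have h1 := hπ.smooth_action (EuclideanSpace ℝ (Fin 10)) (extChartAt (𝓡 10) p).target
    (extChartAt (𝓡 10) p).symm (fun _ => h) (contMDiffOn_extChartAt_symm p) contDiffOn_const
  have h2 : ContMDiffOn (𝓡 10) (𝓡 10) ∞
      (fun q : P => (extChartAt (𝓡 10) p).symm (extChartAt (𝓡 10) p q) <• h)
      (extChartAt (𝓡 10) p).source := by
    have := h1.comp (contMDiffOn_extChartAt (I := 𝓡 10) (n := ∞) (x := p))
      (by rw [← extChartAt_source (𝓡 10)]; exact (extChartAt (𝓡 10) p).mapsTo)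
    rwa [← extChartAt_source (𝓡 10)] at this
  refine ((h2.congr fun q hq => ?_).contMDiffAt (extChartAt_source_mem_nhds p))
  rw [(extChartAt (𝓡 10) p).left_inv hq]

lemma contMDiff_orbit {π : P → M} (hπ : IsPrincipalBundle k π) (p : P) {h : ℝ → H k}
    (hh : ContDiff ℝ ∞ fun t => ent (mat (h t : G k))) :
    ContMDiff 𝓘(ℝ, ℝ) (𝓡 10) ∞ fun t => p <• h t := by
  rw [← contMDiffOn_univ]
  exact hπ.smooth_action ℝ univ (fun _ => p) h contMDiffOn_const hh.contDiffOn

end IsPrincipalBundle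

namespace CartanGeometry

variable (X : CartanGeometry k M P)

/-- The differential of the bundle projection. -/
def dproj (p : P) : EuclideanSpace ℝ (Fin 10) →L[ℝ] EuclideanSpace ℝ (Fin 4) :=
  mfderiv (𝓡 10) (𝓡 4) X.π p

/-- The differential of the right translation by `h`. -/
def dright (_X : CartanGeometry k M P) (h : H k) (p : P) :
    EuclideanSpace ℝ (Fin 10) →L[ℝ] EuclideanSpace ℝ (Fin 10) :=
  mfderiv (𝓡 10) (𝓡 10) (fun q : P => q <• h) p

/-- The Cartan connection with values in matrices. -/
def conn (p : P) : EuclideanSpace ℝ (Fin 10) →ₗ[ℝ] Mat :=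
  (lieG k).subtype ∘ₗ (X.A p).toLinearMap

lemma conn_mem (p : P) (w : EuclideanSpace ℝ (Fin 10)) : X.conn p w ∈ lieG k := (X.A p w).2

lemma conn_injective (p : P) : Function.Injective (X.conn p) :=
  Subtype.val_injective.comp (X.A p).injective

lemma exists_conn_eq (p : P) {Y : Mat} (hY : Y ∈ lieG k) : ∃ w, X.conn p w = Y :=
  ⟨(X.A p).symm ⟨Y, hY⟩, congrArg Subtype.val ((X.A p).apply_symm_apply ⟨Y, hY⟩)⟩

lemma omega_eq (p : P) (w : EuclideanSpace ℝ (Fin 10)) :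
    (X.omega p w : Mat) = blockPart (X.conn p w) := rfl

lemma soldering_eq (p : P) (w : EuclideanSpace ℝ (Fin 10)) :
    (X.soldering p w : Mat) = X.conn p w - blockPart (X.conn p w) := rfl

lemma hasMFDerivAt_proj (p : P) : HasMFDerivAt (𝓡 10) (𝓡 4) X.π p (X.dproj p) :=
  (X.principal.smooth_proj.mdifferentiableAt (by simp)).hasMFDerivAt

lemma hasMFDerivAt_right (h : H k) (p : P) :
    HasMFDerivAt (𝓡 10) (𝓡 10) (fun q : P => q <• h) p (X.dright h p) :=
  ((X.principal.contMDiff_right h).mdifferentiableAt (by simp)).hasMFDerivAt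

lemma conn_dright (h : H k) (p : P) (w : EuclideanSpace ℝ (Fin 10)) :
    X.conn (p <• h) (X.dright h p w) = mat ((h : G k)⁻¹) * X.conn p w * mat (h : G k) :=
  X.equivariant h p w

lemma dproj_dright (h : H k) (p : P) (w : EuclideanSpace ℝ (Fin 10)) :
    X.dproj (p <• h) (X.dright h p w) = X.dproj p w := by
  have h1 := (X.hasMFDerivAt_proj (p <• h)).comp p (X.hasMFDerivAt_right h p)
  have h2 : HasMFDerivAt (𝓡 10) (𝓡 4) (X.π ∘ fun q : P => q <• h) p
      (X.dproj p : TangentSpace (𝓡 10) p →L[ℝ] TangentSpace (𝓡 4) (X.π (p <• h))) :=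
    (X.hasMFDerivAt_proj p).congr_of_eventuallyEq
      (Eventually.of_forall fun q => X.principal.proj_right q h)
  exact DFunLike.congr_fun (hasMFDerivAt_unique h1 h2) w

/-- The local section, translated so as to pass through `p`, is a right inverse of `π`; its
differential is a right inverse of `dπ`. -/
lemma dproj_surjective (p : P) : Function.Surjective (X.dproj p) := by
  obtain ⟨U, hU, hx, s, τ, hs, hπs, -, hsτ⟩ := X.principal.locally_trivial (X.π p)
  have hsm : MDifferentiableAt (𝓡 4) (𝓡 10) (fun y => s y <• τ p) (X.π p) :=
    ((X.principal.contMDiff_right (τ p)).contMDiffAt.comp _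
      (hs.contMDiffAt (hU.mem_nhds hx))).mdifferentiableAt (by simp)
  -- The equality `p = s (π p) h` is generalized to a variable point because the tangent spaces and
  -- differentials depend on that point.
  suffices H : ∀ q, q = s (X.π p) <• τ p → Function.Surjective (X.dproj q) from H p (hsτ p hx)
  rintro q rfl
  intro v
  have h1 := (X.hasMFDerivAt_proj (s (X.π p) <• τ p)).comp (X.π p) hsm.hasMFDerivAt
  have h2 : HasMFDerivAt (𝓡 4) (𝓡 4) (X.π ∘ fun y => s y <• τ p) (X.π p)
      (ContinuousLinearMap.id ℝ (EuclideanSpace ℝ (Fin 4)) :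
        TangentSpace (𝓡 4) (X.π p) →L[ℝ] TangentSpace (𝓡 4) (X.π (s (X.π p) <• τ p))) := by
    refine (hasMFDerivAt_id (X.π p)).congr_of_eventuallyEq ?_
    filter_upwards [hU.mem_nhds hx] with y hy
    simp [X.principal.proj_right, hπs y hy]
  exact ⟨_, DFunLike.congr_fun (hasMFDerivAt_unique h1 h2) v⟩

/-- Fundamental vector fields are velocities of orbits of one-parameter subgroups. -/
lemma exists_orbit_velocity (p : P) {Y : Mat} (hY : Y ∈ lieH k) :
    ∃ h : ℝ → H k, h 0 = 1 ∧ HasDerivAt (fun t => ent (mat (h t : G k))) (ent Y) 0 ∧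
      ∃ (c' : ℝ →L[ℝ] EuclideanSpace ℝ (Fin 10)),
        HasMFDerivAt 𝓘(ℝ, ℝ) (𝓡 10) (fun t => p <• h t) 0 c' ∧
          X.conn (p <• h 0) (c' 1) = Y := by
  obtain ⟨h, h0, hs, hd⟩ := exists_oneParameter hY
  have hm := ((X.principal.contMDiff_orbit p hs).mdifferentiableAt (by simp) :
    MDifferentiableAt 𝓘(ℝ, ℝ) (𝓡 10) _ (0 : ℝ)).hasMFDerivAt
  refine ⟨h, h0, hd, _, hm, ?_⟩
  refine (X.maurerCartan p h hs 0).trans ?_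
  rw [hd.deriv, h0]
  change 1 * Y = Y
  rw [one_mul]

/-- Since `A` is injective, `w` must be the velocity of the orbit of a one-parameter subgroup of
`H`, and `π` is constant on orbits. -/
lemma dproj_eq_zero_of_conn_mem {p : P} {w : EuclideanSpace ℝ (Fin 10)}
    (hw : X.conn p w ∈ lieH k) : X.dproj p w = 0 := by
  obtain ⟨h, h0, -, c', hc, hY⟩ := X.exists_orbit_velocity p hw
  have hp : p = p <• h 0 := by rw [h0]; simp
  have key : ∀ q, q = p <• h 0 → ∀ u, X.conn q u = X.conn p w → X.dproj q u = 0 := by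
    rintro q rfl u hu
    rw [← hY] at hu
    rw [X.conn_injective _ hu]
    have h1 := (X.hasMFDerivAt_proj (p <• h 0)).comp 0 hc
    have h2 : HasMFDerivAt 𝓘(ℝ, ℝ) (𝓡 4) (X.π ∘ fun t => p <• h t) 0
        (0 : TangentSpace 𝓘(ℝ, ℝ) (0 : ℝ) →L[ℝ] TangentSpace (𝓡 4) (X.π (p <• h 0))) :=
      (hasMFDerivAt_const (X.π p) (0 : ℝ)).congr_of_eventuallyEq
        (Eventually.of_forall fun t => X.principal.proj_right p (h t))
    exact DFunLike.congr_fun (hasMFDerivAt_unique h1 h2) (1 : ℝ)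
  exact key p hp w rfl

lemma soldering_eq_zero_iff {p : P} {w : EuclideanSpace ℝ (Fin 10)} :
    X.soldering p w = 0 ↔ X.conn p w ∈ lieH k := by
  rw [← Submodule.coe_eq_zero, soldering_eq, lieH, Submodule.mem_inf, LinearMap.mem_ker,
    LinearMap.sub_apply, LinearMap.id_apply, sub_eq_zero, sub_eq_zero, eq_comm]
  exact ⟨fun h => ⟨X.conn_mem p w, h⟩, fun h => h.2⟩

/-- The kernel of `e` lies in that of `dπ`. The latter has dimension `10 - 4`, and the former at
least `10 - 4` because `dim 𝔭 ≤ 4`; so they coincide. -/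
lemma dproj_eq_zero_iff {p : P} {w : EuclideanSpace ℝ (Fin 10)} :
    X.dproj p w = 0 ↔ X.soldering p w = 0 := by
  let S : EuclideanSpace ℝ (Fin 10) →ₗ[ℝ] lieP k := X.soldering p
  let D : EuclideanSpace ℝ (Fin 10) →ₗ[ℝ] EuclideanSpace ℝ (Fin 4) := (X.dproj p).toLinearMap
  have hle : LinearMap.ker S ≤ LinearMap.ker D := fun u hu =>
    X.dproj_eq_zero_of_conn_mem (X.soldering_eq_zero_iff.1 hu)
  have hD : Module.finrank ℝ (LinearMap.range D) = 4 := by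
    rw [LinearMap.range_eq_top.2 (X.dproj_surjective p)]; simp
  have h1 := LinearMap.finrank_range_add_finrank_ker D
  have h2 := LinearMap.finrank_range_add_finrank_ker S
  have h3 := (Submodule.finrank_le (LinearMap.range S)).trans finrank_lieP_le
  rw [finrank_euclideanSpace_fin] at h1 h2
  have heq := Submodule.eq_of_le_of_finrank_le hle (by omega)
  exact (SetLike.ext_iff.1 heq w).symm

/-! ### Horizontal lifts and the coframe -/

lemma eq_of_dproj_eq_of_omega_eq {p : P} {w w' : EuclideanSpace ℝ (Fin 10)}
    (h1 : X.dproj p w = X.dproj p w') (h2 : X.omega p w = X.omega p w') : w = w' := by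
  have h3 : X.dproj p (w - w') = 0 := by rw [map_sub, h1, sub_self]
  rw [dproj_eq_zero_iff, ← Submodule.coe_eq_zero, soldering_eq, map_sub, map_sub] at h3
  have h4 := congrArg Subtype.val h2
  rw [omega_eq, omega_eq] at h4
  rw [h4, sub_self, sub_zero, sub_eq_zero] at h3
  exact X.conn_injective p h3

/-- The horizontal lift, between fixed vector spaces. -/
def hlift (p : P) (v : EuclideanSpace ℝ (Fin 4)) : EuclideanSpace ℝ (Fin 10) :=
  X.horizontalLift p v

lemma hlift_spec (p : P) (v : EuclideanSpace ℝ (Fin 4)) :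
    X.dproj p (X.hlift p v) = v ∧ X.omega p (X.hlift p v) = 0 := by
  have : ∃ w : EuclideanSpace ℝ (Fin 10), X.dproj p w = v ∧ X.omega p w = 0 := by
    obtain ⟨w, rfl⟩ := X.dproj_surjective p v
    -- Any lift becomes horizontal after subtracting the vertical vector on which `A` takes the
    -- value `ω(w)`.
    obtain ⟨u, hu⟩ := X.exists_conn_eq p (X.omega p w).2.1
    refine ⟨w - u, ?_, ?_⟩
    · have hu' : X.conn p u ∈ lieH k := by rw [hu]; exact (X.omega p w).2
      rw [map_sub, X.dproj_eq_zero_of_conn_mem hu', sub_zero]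
    · rw [← Submodule.coe_eq_zero, omega_eq, map_sub, hu, omega_eq, map_sub, blockPart_blockPart,
        sub_self]
  exact Classical.epsilon_spec this

lemma dproj_hlift (p : P) (v : EuclideanSpace ℝ (Fin 4)) : X.dproj p (X.hlift p v) = v :=
  (X.hlift_spec p v).1

lemma blockPart_conn_hlift (p : P) (v : EuclideanSpace ℝ (Fin 4)) :
    blockPart (X.conn p (X.hlift p v)) = 0 := by
  rw [← omega_eq, (X.hlift_spec p v).2]; rfl

lemma eq_hlift {p : P} {v : EuclideanSpace ℝ (Fin 4)} {w : EuclideanSpace ℝ (Fin 10)}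
    (h1 : X.dproj p w = v) (h2 : blockPart (X.conn p w) = 0) : w = X.hlift p v :=
  X.eq_of_dproj_eq_of_omega_eq (by rw [h1, dproj_hlift])
    (Subtype.ext (by rw [omega_eq, omega_eq, h2, blockPart_conn_hlift]))

/-- The coframe with values in matrices. -/
def cof (p : P) (v : EuclideanSpace ℝ (Fin 4)) : Mat := X.coframe p v

lemma cof_mem (p : P) (v : EuclideanSpace ℝ (Fin 4)) : X.cof p v ∈ lieP k :=
  (X.coframe p v).2

lemma cof_eq_conn_hlift (p : P) (v : EuclideanSpace ℝ (Fin 4)) :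
    X.cof p v = X.conn p (X.hlift p v) := by
  change (X.soldering p (X.hlift p v) : Mat) = _
  rw [soldering_eq, blockPart_conn_hlift, sub_zero]

/-- Two lifts of a vector differ by an element of `ker dπ = ker e`, so any lift computes the
coframe. Linearity and surjectivity of the coframe follow from this. -/
lemma cof_dproj (p : P) (w : EuclideanSpace ℝ (Fin 10)) :
    X.cof p (X.dproj p w) = X.conn p w - blockPart (X.conn p w) := by
  have h : X.dproj p (X.hlift p (X.dproj p w) - w) = 0 := by
    rw [map_sub, dproj_hlift, sub_self]
  rw [dproj_eq_zero_iff, ← Submodule.coe_eq_zero, soldering_eq, map_sub, map_sub,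
    blockPart_conn_hlift, ← cof_eq_conn_hlift] at h
  rw [← sub_eq_zero, ← h]; abel

lemma cof_add (p : P) (v w : EuclideanSpace ℝ (Fin 4)) :
    X.cof p (v + w) = X.cof p v + X.cof p w := by
  obtain ⟨v, rfl⟩ := X.dproj_surjective p v
  obtain ⟨w, rfl⟩ := X.dproj_surjective p w
  rw [← map_add, cof_dproj, cof_dproj, cof_dproj, map_add, map_add]; abel

lemma cof_smul (p : P) (c : ℝ) (v : EuclideanSpace ℝ (Fin 4)) :
    X.cof p (c • v) = c • X.cof p v := by
  obtain ⟨v, rfl⟩ := X.dproj_surjective p v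
  rw [← map_smul, cof_dproj, cof_dproj, map_smul, map_smul, smul_sub]

lemma cof_zero (p : P) : X.cof p 0 = 0 := by
  rw [← zero_smul ℝ (0 : EuclideanSpace ℝ (Fin 4)), cof_smul, zero_smul]

lemma cof_injective (p : P) : Function.Injective (X.cof p) := by
  intro v w h
  rw [cof_eq_conn_hlift, cof_eq_conn_hlift] at h
  rw [← X.dproj_hlift p v, X.conn_injective p h, dproj_hlift]

lemma exists_cof_eq (p : P) {Y : Mat} (hY : Y ∈ lieP k) : ∃ v, X.cof p v = Y := by
  obtain ⟨w, hw⟩ := X.exists_conn_eq p hY.1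
  refine ⟨X.dproj p w, ?_⟩
  rw [cof_dproj, hw, LinearMap.mem_ker.1 hY.2, sub_zero]

lemma dright_hlift (h : H k) (p : P) (v : EuclideanSpace ℝ (Fin 4)) :
    X.dright h p (X.hlift p v) = X.hlift (p <• h) v := by
  refine X.eq_hlift (by rw [dproj_dright, dproj_hlift]) ?_
  rw [conn_dright, blockPart_conj, blockPart_conn_hlift, mul_zero, zero_mul]

lemma cof_right (h : H k) (p : P) (v : EuclideanSpace ℝ (Fin 4)) :
    X.cof (p <• h) v = mat ((h : G k)⁻¹) * X.cof p v * mat (h : G k) := by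
  rw [cof_eq_conn_hlift, ← dright_hlift, conn_dright, ← cof_eq_conn_hlift]

end CartanGeometry

end Bundle

end SpacetimeCartan

namespace SpacetimeCartan

/-! ### Calculus of matrix-valued maps -/

lemma hasDerivWithinAt_ent_mul {A B : ℝ → Mat} {A' B' : Mat} {S : Set ℝ} {t : ℝ}
    (hA : HasDerivWithinAt (fun s => ent (A s)) (ent A') S t)
    (hB : HasDerivWithinAt (fun s => ent (B s)) (ent B') S t) :
    HasDerivWithinAt (fun s => ent (A s * B s)) (ent (A' * B t + A t * B')) S t := by
  refine hasDerivWithinAt_pi.2 fun i => hasDerivWithinAt_pi.2 fun j => ?_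
  have hA' := fun l => hasDerivWithinAt_pi.1 (hasDerivWithinAt_pi.1 hA i) l
  have hB' := fun l => hasDerivWithinAt_pi.1 (hasDerivWithinAt_pi.1 hB l) j
  have := HasDerivWithinAt.fun_sum (u := Finset.univ) fun l _ => (hA' l).fun_mul (hB' l)
  simpa only [ent, Matrix.mul_apply, Matrix.add_apply, Finset.sum_add_distrib] using this

/-- By `mat_inv_eq` this is `(h, Y) ↦ h⁻¹ Y h` on `H`, written as a polynomial in the entries so
that no matrix inversion has to be differentiated. -/
lemma contDiff_ent_conj : ContDiff ℝ ∞ fun z : (Idx → Idx → ℝ) × (Idx → Idx → ℝ) =>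
    ent (reflection * (Matrix.of z.1).transpose * reflection * Matrix.of z.2 * Matrix.of z.1) := by
  refine contDiff_pi.2 fun i => contDiff_pi.2 fun j => ?_
  simp only [ent, Matrix.mul_apply, Matrix.transpose_apply, Matrix.of_apply]
  fun_prop

/-- A linear map between matrix spaces, acting on entries. -/
def entMap (l : Mat →ₗ[ℝ] Mat) : (Idx → Idx → ℝ) →L[ℝ] (Idx → Idx → ℝ) :=
  LinearMap.toContinuousLinearMap
    { toFun := fun Y => ent (l (Matrix.of Y))
      map_add' := fun Y Z => by rw [← Matrix.of_add_of, map_add]; rfl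
      map_smul' := fun c Y => by rw [← Matrix.smul_of, map_smul]; rfl }

lemma entMap_ent (l : Mat →ₗ[ℝ] Mat) (Y : Mat) : entMap l (ent Y) = ent (l Y) := rfl

lemma ent_injective : Function.Injective ent := fun _ _ h => h

/-! ### Equivariant functions and the induced connection -/

section Connection

variable {k : Model} {M P : Type*}
  [TopologicalSpace M] [ChartedSpace (EuclideanSpace ℝ (Fin 4)) M] [IsManifold (𝓡 4) ∞ M]
  [TopologicalSpace P] [ChartedSpace (EuclideanSpace ℝ (Fin 10)) P] [IsManifold (𝓡 10) ∞ P]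
  [MulAction (H k)ᵐᵒᵖ P]

/-- The endomorphism of matrices with kernel `𝔭`. -/
def lieProjCompl (k : Model) : Mat →ₗ[ℝ] Mat where
  toFun Y := Y - transvection k Y.toBlocks₁₂
  map_add' Y Z := by
    ext (i | i) (j | j) <;>
      (simp [transvection, Matrix.toBlocks₁₂, Matrix.mul_apply, add_mul, Finset.sum_add_distrib]
       try ring)
  map_smul' c Y := by
    ext (i | i) (j | j) <;>
      (simp [transvection, Matrix.toBlocks₁₂, Matrix.mul_apply, mul_assoc, ← Finset.mul_sum]
       try ring)

lemma lieProjCompl_eq_zero_iff {Y : Mat} : lieProjCompl k Y = 0 ↔ Y ∈ lieP k := by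
  rw [mem_lieP_iff]
  change Y - transvection k Y.toBlocks₁₂ = 0 ↔ _
  rw [sub_eq_zero]
  constructor
  · exact fun h => ⟨_, h⟩
  · rintro ⟨v, rfl⟩
    rfl

/-- All tangent spaces are the same model vector space, so transport along an equality of base
points does nothing. -/
lemma eq_rec_tangentSpace {x y : M} (h : y = x) (u : TangentSpace (𝓡 4) x) :
    ((h ▸ u : TangentSpace (𝓡 4) y) : EuclideanSpace ℝ (Fin 4)) = u := by
  subst h; rfl

lemma contMDiff_unit_section : ContMDiff 𝓘(ℝ, ℝ) 𝓘(ℝ, ℝ).tangent ∞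
    fun s : ℝ => (⟨s, (1 : ℝ)⟩ : TangentBundle 𝓘(ℝ, ℝ) ℝ) :=
  contMDiff_vectorSpace_iff_contDiff.2 (contDiff_const (c := (1 : ℝ)))

lemma contMDiffOn_velocity {n : ℕ} {N : Type*} [TopologicalSpace N]
    [ChartedSpace (EuclideanSpace ℝ (Fin n)) N] [IsManifold (𝓡 n) ∞ N] {c : ℝ → N}
    (hc : ContMDiffOn 𝓘(ℝ, ℝ) (𝓡 n) ∞ c (Icc 0 1)) :
    ContMDiffOn 𝓘(ℝ, ℝ) (𝓡 n).tangent ∞ (fun s => (⟨c s,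
      mfderivWithin 𝓘(ℝ, ℝ) (𝓡 n) c (Icc 0 1) s (1 : ℝ)⟩ : TangentBundle (𝓡 n) N)) (Icc 0 1) := by
  have : IsManifold (𝓡 n) 1 N := IsManifold.of_le (n := ∞) (by simp)
  have h := hc.contMDiffOn_tangentMapWithin (m := ∞) (by simp)
    (uniqueDiffOn_Icc_zero_one.uniqueMDiffOn)
  exact h.comp contMDiff_unit_section.contMDiffOn fun s hs => hs

namespace CartanGeometry

variable (X : CartanGeometry k M P)

/-- The equivariant function `P → 𝔭` of a vector field on `M`. -/
def frameFun (Y : M → EuclideanSpace ℝ (Fin 4)) (q : P) : Idx → Idx → ℝ := ent (X.cof q (Y (X.π q)))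

lemma frameFun_right (Y : M → EuclideanSpace ℝ (Fin 4)) (h : H k) (q : P) :
    X.frameFun Y (q <• h) = conjEnt h (X.frameFun Y q) := by
  rw [frameFun, X.principal.proj_right, cof_right, frameFun, conjEnt_ent]

/-- The derivative of the equivariant function of a vector field. -/
def dframeFun (Y : M → EuclideanSpace ℝ (Fin 4)) (p : P) :
    EuclideanSpace ℝ (Fin 10) →L[ℝ] (Idx → Idx → ℝ) :=
  mfderiv (𝓡 10) 𝓘(ℝ, Idx → Idx → ℝ) (X.frameFun Y) p

variable {X}

lemma hasMFDerivAt_frameFun {Y : M → EuclideanSpace ℝ (Fin 4)} {p : P}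
    (hY : MDifferentiableAt (𝓡 10) 𝓘(ℝ, Idx → Idx → ℝ) (X.frameFun Y) p) :
    HasMFDerivAt (𝓡 10) 𝓘(ℝ, Idx → Idx → ℝ) (X.frameFun Y) p (X.dframeFun Y p) :=
  hY.hasMFDerivAt

lemma dframeFun_dright {Y : M → EuclideanSpace ℝ (Fin 4)} {p : P} {h : H k}
    (hY : MDifferentiableAt (𝓡 10) 𝓘(ℝ, Idx → Idx → ℝ) (X.frameFun Y) p)
    (hY' : MDifferentiableAt (𝓡 10) 𝓘(ℝ, Idx → Idx → ℝ) (X.frameFun Y) (p <• h))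
    (w : EuclideanSpace ℝ (Fin 10)) :
    X.dframeFun Y (p <• h) (X.dright h p w) = conjEnt h (X.dframeFun Y p w) := by
  have h1 := (hasMFDerivAt_frameFun hY').comp p (X.hasMFDerivAt_right h p)
  have h2 := ((conjEnt h).hasMFDerivAt (x := X.frameFun Y p)).comp p (hasMFDerivAt_frameFun hY)
  have h3 : (X.frameFun Y ∘ fun q : P => q <• h) = conjEnt h ∘ X.frameFun Y :=
    funext fun q => X.frameFun_right Y h q
  rw [h3] at h1
  exact DFunLike.congr_fun (hasMFDerivAt_unique h1 h2) w

/-- The function takes values in the linear subspace `𝔭 = ker (lieProjCompl k)`, so its derivative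
does too. -/
lemma dframeFun_mem {Y : M → EuclideanSpace ℝ (Fin 4)} {p : P}
    (hY : MDifferentiableAt (𝓡 10) 𝓘(ℝ, Idx → Idx → ℝ) (X.frameFun Y) p)
    (w : EuclideanSpace ℝ (Fin 10)) : Matrix.of (X.dframeFun Y p w) ∈ lieP k := by
  have h1 := ((entMap (lieProjCompl k)).hasMFDerivAt (x := X.frameFun Y p)).comp p
    (hasMFDerivAt_frameFun hY)
  have h2 : (entMap (lieProjCompl k) ∘ X.frameFun Y) = fun _ => 0 := funext fun q => by
    change entMap (lieProjCompl k) (ent (X.cof q (Y (X.π q)))) = 0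
    rw [entMap_ent, lieProjCompl_eq_zero_iff.2 (X.cof_mem _ _)]; rfl
  rw [h2] at h1
  have := DFunLike.congr_fun (hasMFDerivAt_unique h1 (hasMFDerivAt_const _ _)) w
  exact lieProjCompl_eq_zero_iff.1 this

variable (X) in
/-- The induced connection, between fixed vector spaces. -/
def nablaVec (Y : M → EuclideanSpace ℝ (Fin 4)) (x : M) (v : EuclideanSpace ℝ (Fin 4)) :
    EuclideanSpace ℝ (Fin 4) := X.inducedConnection Y x v

/-- The induced connection may be computed in any frame. -/
lemma cof_nablaVec {Y : M → EuclideanSpace ℝ (Fin 4)} {p : P} {x : M} (hx : X.π p = x)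
    (hY : ∀ q, X.π q = x → MDifferentiableAt (𝓡 10) 𝓘(ℝ, Idx → Idx → ℝ) (X.frameFun Y) q)
    (v : EuclideanSpace ℝ (Fin 4)) :
    ent (X.cof p (X.nablaVec Y x v)) = X.dframeFun Y p (X.hlift p v) := by
  have hex : ∃ u : TangentSpace (𝓡 4) x, ∃ (p : P) (hp : X.π p = x),
      ent (X.coframe p (hp ▸ u)) =
        mfderiv (𝓡 10) 𝓘(ℝ, Idx → Idx → ℝ) (fun q : P => ent (X.coframe q (Y (X.π q)))) p
          (X.horizontalLift p (hp ▸ (v : TangentSpace (𝓡 4) x))) := by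
    obtain ⟨u, hu⟩ := X.exists_cof_eq p (dframeFun_mem (hY p hx) (X.hlift p v))
    refine ⟨u, p, hx, ?_⟩
    rw [eq_rec_tangentSpace hx u, eq_rec_tangentSpace hx v]
    exact congrArg ent hu
  obtain ⟨q, hq, h⟩ := Classical.epsilon_spec hex
  change ent (X.coframe q (hq ▸ X.inducedConnection Y x v)) = _ at h
  rw [eq_rec_tangentSpace hq, eq_rec_tangentSpace hq v] at h
  replace h : ent (X.cof q (X.nablaVec Y x v)) = X.dframeFun Y q (X.hlift q v) := h
  -- The choice operator gives the identity only in some frame `q` over `x`; both sides are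
  -- equivariant, so it carries over to `p = q g`.
  obtain ⟨g, rfl⟩ := (X.principal.fibre q p).1 (hq.trans hx.symm)
  rw [cof_right, ← conjEnt_ent, h, ← dright_hlift, dframeFun_dright (hY q hq) (hY _ hx)]

/-- The derivative of an equivariant function along a fundamental vector field. -/
lemma dframeFun_vertical {Y : M → EuclideanSpace ℝ (Fin 4)} {p : P}
    (hY : MDifferentiableAt (𝓡 10) 𝓘(ℝ, Idx → Idx → ℝ) (X.frameFun Y) p)
    {w : EuclideanSpace ℝ (Fin 10)} (hw : X.conn p w ∈ lieH k) :
    X.dframeFun Y p w =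
      ent (X.cof p (Y (X.π p)) * X.conn p w - X.conn p w * X.cof p (Y (X.π p))) := by
  obtain ⟨h, h0, hh, c', hc, hW⟩ := X.exists_orbit_velocity p hw
  have hp : p = p <• h 0 := by rw [h0]; simp
  have key : ∀ q, q = p <• h 0 → ∀ u, X.conn q u = X.conn p w →
      MDifferentiableAt (𝓡 10) 𝓘(ℝ, Idx → Idx → ℝ) (X.frameFun Y) q → X.dframeFun Y q u =
      ent (X.cof q (Y (X.π q)) * X.conn p w - X.conn p w * X.cof q (Y (X.π q))) := by
    rintro q rfl u hu hq
    rw [← hW] at hu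
    rw [X.conn_injective _ hu]
    have h1 := (hasMFDerivAt_frameFun hq).comp 0 hc
    have h1' : HasFDerivAt (fun t => X.frameFun Y (p <• h t)) (X.dframeFun Y (p <• h 0) ∘L c')
        (0 : ℝ) := hasMFDerivAt_iff_hasFDerivAt.1 h1
    have h2 : HasDerivAt (fun t => ent (X.cof (p <• h t) (Y (X.π (p <• h t)))))
        (ent (Matrix.of (X.dframeFun Y (p <• h 0) (c' 1)))) 0 :=
      h1'.hasDerivAt
    have h3 := hasDerivWithinAt_ent_mul hh.hasDerivWithinAt (h2.hasDerivWithinAt (s := univ))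
    -- Equivariance is used in the form `h f(p h) = f(p) h`. Differentiating at `h = 1` gives `Y f +
    -- f' = f Y`, again without differentiating an inverse.
    have h4 : ∀ t, mat (h t : G k) * X.cof (p <• h t) (Y (X.π (p <• h t))) =
        X.cof p (Y (X.π p)) * mat (h t : G k) := by
      intro t
      rw [X.principal.proj_right, cof_right, ← mul_assoc, ← mul_assoc, mat_mul_inv, one_mul]
    simp_rw [h4] at h3
    have h5 := hasDerivWithinAt_ent_mul (A := fun _ => X.cof p (Y (X.π p))) (A' := 0)
      (hasDerivWithinAt_const (0 : ℝ) univ _) (hh.hasDerivWithinAt)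
    have h6 := ent_injective ((hasDerivWithinAt_univ.1 h3).unique (hasDerivWithinAt_univ.1 h5))
    rw [← hp, h0] at h6
    have h7 : mat ((1 : H k) : G k) = 1 := rfl
    rw [h7, one_mul, zero_mul, zero_add] at h6
    rw [← hp]
    exact congrArg ent (eq_sub_of_add_eq' h6)
  exact key p hp w rfl hY

end CartanGeometry

end Connection

end SpacetimeCartan

namespace SpacetimeCartan

/-- The projection onto the off-diagonal blocks. -/
def offBlock : Mat →ₗ[ℝ] Mat := LinearMap.id - blockPart

lemma offBlock_apply (Y : Mat) : offBlock Y = Y - blockPart Y := rfl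

section CovariantDerivative

variable {k : Model} {M P : Type*}
  [TopologicalSpace M] [ChartedSpace (EuclideanSpace ℝ (Fin 4)) M] [IsManifold (𝓡 4) ∞ M]
  [TopologicalSpace P] [ChartedSpace (EuclideanSpace ℝ (Fin 10)) P] [IsManifold (𝓡 10) ∞ P]
  [MulAction (H k)ᵐᵒᵖ P]

/-! ### Coordinate vector fields -/

/-- The trivialization of the tangent bundle given by the chart at `x₀`. -/
abbrev chartTriv (x₀ : M) : Bundle.Trivialization (EuclideanSpace ℝ (Fin 4))
    (Bundle.TotalSpace.proj : TangentBundle (𝓡 4) M → M) :=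
  trivializationAt (EuclideanSpace ℝ (Fin 4)) (TangentSpace (𝓡 4) : M → Type _) x₀

/-- The vector field with constant components `c` in the chart at `x₀`. -/
def chartField (x₀ : M) (c : EuclideanSpace ℝ (Fin 4)) (y : M) : EuclideanSpace ℝ (Fin 4) :=
  (chartTriv x₀).symm y c

lemma chartField_eq_sum {x₀ y : M} (hy : y ∈ (chartTriv x₀).baseSet)
    (c : EuclideanSpace ℝ (Fin 4)) :
    chartField x₀ c y = ∑ i, c i • chartField x₀ (EuclideanSpace.basisFun (Fin 4) ℝ i) y := by
  let l : EuclideanSpace ℝ (Fin 4) →ₗ[ℝ] EuclideanSpace ℝ (Fin 4) :=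
    (chartTriv x₀).symmₗ ℝ y
  have hl : ∀ c, chartField x₀ c y = l c := fun c =>
    (congrFun (Bundle.Trivialization.coe_symmₗ (R := ℝ) (chartTriv x₀) hy) c).symm
  simp_rw [hl, ← map_smul, ← map_sum]
  congr 1
  exact ((EuclideanSpace.basisFun (Fin 4) ℝ).sum_repr c).symm

/-- Expanding around a fixed `c` makes the coefficients vanish at `d = c`. In the product rule only
the field with frozen components `c` is then differentiated, as in `covDerivAlong`. -/
lemma chartField_eq_add_sum {x₀ y : M} (hy : y ∈ (chartTriv x₀).baseSet)
    (c d : EuclideanSpace ℝ (Fin 4)) :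
    chartField x₀ d y = chartField x₀ c y +
      ∑ i, (d i - c i) • chartField x₀ (EuclideanSpace.basisFun (Fin 4) ℝ i) y := by
  simp_rw [sub_smul, Finset.sum_sub_distrib]
  rw [← chartField_eq_sum hy, ← chartField_eq_sum hy]
  abel

lemma contMDiffOn_chartField (x₀ : M) (c : EuclideanSpace ℝ (Fin 4)) :
    ContMDiffOn (𝓡 4) (𝓡 4).tangent ∞
      (fun y => (⟨y, chartField x₀ c y⟩ : TangentBundle (𝓡 4) M)) (chartTriv x₀).baseSet := by
  refine (Bundle.Trivialization.contMDiffOn_section_baseSet_iff (chartTriv x₀)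
    (E := (TangentSpace (𝓡 4) : M → Type _)) (s := chartField x₀ c)).2 ?_
  refine (contMDiffOn_const (c := c)).congr fun y hy => ?_
  exact congrArg Prod.snd ((chartTriv x₀).apply_mk_symm hy c)

namespace CartanGeometry

variable {X : CartanGeometry k M P}

/-- Differentiating `π ∘ s = id` shows that `ds(v)` is a lift of `v`, to which `cof_dproj` applies.
-/
lemma cof_section {U : Set M} (hU : IsOpen U) {s : M → P}
    (hs : ContMDiffOn (𝓡 4) (𝓡 10) ∞ s U) (hπ : ∀ y ∈ U, X.π (s y) = y) {y : M} (hy : y ∈ U)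
    (v : EuclideanSpace ℝ (Fin 4)) :
    X.cof (s y) v = offBlock (X.conn (s y)
      ((mfderivWithin (𝓡 4) (𝓡 10) s U y : EuclideanSpace ℝ (Fin 4) →L[ℝ] _) v)) := by
  have hsm := ((hs y hy).mdifferentiableWithinAt (by simp)).hasMFDerivWithinAt.hasMFDerivAt
    (hU.mem_nhds hy)
  have h1 := (X.hasMFDerivAt_proj (s y)).comp y hsm
  have h2 : HasMFDerivAt (𝓡 4) (𝓡 4) (X.π ∘ s) y
      (ContinuousLinearMap.id ℝ (EuclideanSpace ℝ (Fin 4)) :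
        TangentSpace (𝓡 4) y →L[ℝ] TangentSpace (𝓡 4) (X.π (s y))) := by
    refine (hasMFDerivAt_id y).congr_of_eventuallyEq ?_
    filter_upwards [hU.mem_nhds hy] with z hz
    exact hπ z hz
  have h3 : X.dproj (s y) ((mfderivWithin (𝓡 4) (𝓡 10) s U y :
      EuclideanSpace ℝ (Fin 4) →L[ℝ] _) v) = v :=
    DFunLike.congr_fun (hasMFDerivAt_unique h1 h2) v
  conv_lhs => rw [← h3]
  exact X.cof_dproj _ _

/-- Over a trivializing set `q = s(π q) τ(q)`, so the function is `Ad(τ(q)⁻¹)` applied to the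
`𝔭`-part of `A(ds(Y))` at `π q`, a composite of smooth maps. -/
lemma mdifferentiableAt_frameFun {x₀ : M} {p : P} (hp : X.π p ∈ (chartTriv x₀).baseSet)
    (c : EuclideanSpace ℝ (Fin 4)) :
    MDifferentiableAt (𝓡 10) 𝓘(ℝ, Idx → Idx → ℝ) (X.frameFun (chartField x₀ c)) p := by
  obtain ⟨U, hU, hx, s, τ, hs, hπs, hτ, hsτ⟩ := X.principal.locally_trivial (X.π p)
  have : IsManifold (𝓡 4) 1 M := IsManifold.of_le (n := ∞) (by simp)
  have : IsManifold (𝓡 10) 1 P := IsManifold.of_le (n := ∞) (by simp)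
  have h1 := hs.contMDiffOn_tangentMapWithin (m := ∞) (by simp) hU.uniqueMDiffOn
  have h2 := X.smooth_A.comp_contMDiffOn h1
  have h3 : ContMDiffOn (𝓡 4) 𝓘(ℝ, Idx → Idx → ℝ) ∞ (fun y => ent (X.conn (s y)
      ((mfderivWithin (𝓡 4) (𝓡 10) s U y : EuclideanSpace ℝ (Fin 4) →L[ℝ] _)
        (chartField x₀ c y)))) (U ∩ (chartTriv x₀).baseSet) :=
    h2.comp ((contMDiffOn_chartField x₀ c).mono inter_subset_right) fun y hy => hy.1
  have hnhds : U ∩ (chartTriv x₀).baseSet ∈ 𝓝 (X.π p) :=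
    inter_mem (hU.mem_nhds hx) ((chartTriv x₀).open_baseSet.mem_nhds hp)
  have h4 : MDifferentiableAt (𝓡 10) 𝓘(ℝ, Idx → Idx → ℝ) (fun q =>
      entMap offBlock (ent (X.conn (s (X.π q))
      ((mfderivWithin (𝓡 4) (𝓡 10) s U (X.π q) : EuclideanSpace ℝ (Fin 4) →L[ℝ] _)
        (chartField x₀ c (X.π q)))))) p :=
    (entMap offBlock).differentiableAt.mdifferentiableAt.comp p
      (((h3.contMDiffAt hnhds).mdifferentiableAt (by simp)).comp p
        (X.hasMFDerivAt_proj p).mdifferentiableAt)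
  have hmem : X.π ⁻¹' U ∈ 𝓝 p :=
    (X.hasMFDerivAt_proj p).continuousAt.preimage_mem_nhds (hU.mem_nhds hx)
  have h5 := (hτ.contMDiffAt hmem).mdifferentiableAt (by simp)
  have h6 := (contDiff_ent_conj.differentiable (by simp) _).mdifferentiableAt.comp p
    (h5.prodMk_space h4)
  refine h6.congr_of_eventuallyEq ?_
  filter_upwards [hmem] with q hq
  change ent (X.cof q (chartField x₀ c (X.π q))) =
    ent (reflection * (mat (τ q : G k)).transpose * reflection * (offBlock
      (X.conn (s (X.π q)) ((mfderivWithin (𝓡 4) (𝓡 10) s U (X.π q) :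
        EuclideanSpace ℝ (Fin 4) →L[ℝ] _) (chartField x₀ c (X.π q))))) * mat (τ q : G k))
  rw [← cof_section hU hs hπs hq, ← mat_inv_eq, ← cof_right, ← hsτ q hq]

/-! ### The covariant derivative of the velocity -/

variable {γ : ℝ → M} {C : ℝ → P}

variable (X) in
/-- The Cartan connection evaluated on the velocity of a path in `P`. -/
def pull (C : ℝ → P) (t : ℝ) : Mat :=
  X.conn (C t) (mfderivWithin 𝓘(ℝ, ℝ) (𝓡 10) C (Icc 0 1) t (1 : ℝ))

lemma contDiffOn_pull (hC : ContMDiffOn 𝓘(ℝ, ℝ) (𝓡 10) ∞ C (Icc 0 1)) :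
    ContDiffOn ℝ ∞ (fun s => ent (X.pull C s)) (Icc 0 1) :=
  contMDiffOn_iff_contDiffOn.1 (X.smooth_A.comp_contMDiffOn (contMDiffOn_velocity hC))

lemma velocity_eq_dproj (hC : ContMDiffOn 𝓘(ℝ, ℝ) (𝓡 10) ∞ C (Icc 0 1))
    (hγ : ∀ t ∈ Icc (0 : ℝ) 1, X.π (C t) = γ t) {t : ℝ} (ht : t ∈ Icc (0 : ℝ) 1) :
    (velocity γ t : EuclideanSpace ℝ (Fin 4)) =
      X.dproj (C t) (mfderivWithin 𝓘(ℝ, ℝ) (𝓡 10) C (Icc 0 1) t (1 : ℝ)) := by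
  have h1 := (X.hasMFDerivAt_proj (C t)).comp_hasMFDerivWithinAt t
    ((hC t ht).mdifferentiableWithinAt (by simp)).hasMFDerivWithinAt
  have h2 := h1.congr_of_eventuallyEq (f₁ := γ)
    (by filter_upwards [self_mem_nhdsWithin] with s hs using (hγ s hs).symm) (hγ t ht).symm
  have h3 := h2.mfderivWithin (uniqueDiffOn_Icc_zero_one.uniqueMDiffOn t ht)
  exact DFunLike.congr_fun h3 (1 : ℝ)

/-- The coframe components of the velocity, differentiated along a lift of the path. -/
lemma hasDerivWithinAt_cof_velocity (hγs : ContMDiffOn 𝓘(ℝ, ℝ) (𝓡 4) ∞ γ (Icc 0 1))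
    (hC : ContMDiffOn 𝓘(ℝ, ℝ) (𝓡 10) ∞ C (Icc 0 1))
    (hγ : ∀ t ∈ Icc (0 : ℝ) 1, X.π (C t) = γ t) {t : ℝ} (ht : t ∈ Icc (0 : ℝ) 1) :
    HasDerivWithinAt (fun s => ent (offBlock (X.pull C s)))
      (ent (X.cof (C t) (covDerivAlong X.inducedConnection γ (velocity γ) t) -
        (blockPart (X.pull C t) * offBlock (X.pull C t) -
          offBlock (X.pull C t) * blockPart (X.pull C t)))) (Icc 0 1) t := by
  have hx := hγ t ht
  let vel : ℝ → EuclideanSpace ℝ (Fin 4) := fun s => velocity γ s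
  let comp : ℝ → EuclideanSpace ℝ (Fin 4) := fun s => (chartTriv (γ t) ⟨γ s, vel s⟩).2
  let c' := derivWithin comp (Icc 0 1) t
  let Cv : EuclideanSpace ℝ (Fin 10) := mfderivWithin 𝓘(ℝ, ℝ) (𝓡 10) C (Icc 0 1) t (1 : ℝ)
  have hcomp : HasDerivWithinAt comp c' (Icc 0 1) t := by
    have h := (Bundle.contMDiffWithinAt_totalSpace.1 (contMDiffOn_velocity hγs t ht)).2
    exact ((contMDiffWithinAt_iff_contDiffWithinAt.1 h).differentiableWithinAt
      (by simp)).hasDerivWithinAt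
  have hcof : ∀ s ∈ Icc (0 : ℝ) 1, X.cof (C s) (vel s) = offBlock (X.pull C s) := by
    intro s hs
    have := velocity_eq_dproj (X := X) hC hγ hs
    change X.cof (C s) (velocity γ s : EuclideanSpace ℝ (Fin 4)) = _
    rw [this]
    exact X.cof_dproj _ _
  have hbase : γ t ∈ (chartTriv (γ t)).baseSet :=
    FiberBundle.mem_baseSet_trivializationAt' (γ t)
  have hvel : ∀ s, γ s ∈ (chartTriv (γ t)).baseSet →
      chartField (γ t) (comp s) (γ s) = vel s := fun s hs =>
    (chartTriv (γ t)).symm_apply_apply_mk hs (vel s)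
  let F : EuclideanSpace ℝ (Fin 4) → P → Idx → Idx → ℝ := fun c => X.frameFun (chartField (γ t) c)
  have hFd : ∀ c, ∀ q, X.π q = γ t → MDifferentiableAt (𝓡 10) 𝓘(ℝ, Idx → Idx → ℝ) (F c) q :=
    fun c q hq => mdifferentiableAt_frameFun (by rwa [hq]) c
  have hF : ∀ c, HasDerivWithinAt (fun s => F c (C s))
      (X.dframeFun (chartField (γ t) c) (C t) Cv) (Icc 0 1) t := by
    intro c
    have h1 := (hasMFDerivAt_frameFun (hFd c (C t) hx)).comp_hasMFDerivWithinAt t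
      ((hC t ht).mdifferentiableWithinAt (by simp)).hasMFDerivWithinAt
    have h2 : HasFDerivWithinAt (fun s => F c (C s))
        (X.dframeFun (chartField (γ t) c) (C t) ∘L (mfderivWithin 𝓘(ℝ, ℝ) (𝓡 10) C (Icc 0 1) t :
          ℝ →L[ℝ] EuclideanSpace ℝ (Fin 10))) (Icc 0 1) t :=
      hasMFDerivWithinAt_iff_hasFDerivWithinAt.1 h1
    exact h2.hasDerivWithinAt
  let e : Fin 4 → EuclideanSpace ℝ (Fin 4) := fun i => EuclideanSpace.basisFun (Fin 4) ℝ i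
  let L : EuclideanSpace ℝ (Fin 4) →ₗ[ℝ] Mat :=
    { toFun := X.cof (C t), map_add' := X.cof_add (C t), map_smul' := X.cof_smul (C t) }
  -- Near `t`, the field `γ'` is written through coordinate fields that extend off the path, with
  -- components expanded around their values at `t`.
  have hexpand : ∀ᶠ s in 𝓝[Icc 0 1] t, ent (offBlock (X.pull C s)) =
      F (comp t) (C s) + ∑ i, (comp s i - comp t i) • F (e i) (C s) := by
    have hnear : ∀ᶠ s in 𝓝[Icc 0 1] t, γ s ∈ (chartTriv (γ t)).baseSet :=
      (hγs t ht).continuousWithinAt ((chartTriv (γ t)).open_baseSet.mem_nhds hbase)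
    filter_upwards [hnear, self_mem_nhdsWithin] with s hs hs'
    let Ls : EuclideanSpace ℝ (Fin 4) →ₗ[ℝ] Mat :=
      { toFun := X.cof (C s), map_add' := X.cof_add (C s), map_smul' := X.cof_smul (C s) }
    have h1 : Ls (vel s) = Ls (chartField (γ t) (comp t) (γ s)) +
        ∑ i, (comp s i - comp t i) • Ls (chartField (γ t) (e i) (γ s)) := by
      rw [← hvel s hs, chartField_eq_add_sum hs (comp t) (comp s), map_add, map_sum]
      simp_rw [map_smul, e]
    rw [← hcof s hs']
    change Ls (vel s) = X.cof (C s) (chartField (γ t) (comp t) (X.π (C s))) +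
      ∑ i, (comp s i - comp t i) • X.cof (C s) (chartField (γ t) (e i) (X.π (C s)))
    rw [hγ s hs']
    exact h1
  have hcompi : ∀ i, HasDerivWithinAt (fun s => comp s i - comp t i) (c' i) (Icc 0 1) t := fun i =>
    (((EuclideanSpace.proj (𝕜 := ℝ) i).hasFDerivAt (x := comp t)).comp_hasDerivWithinAt t
      hcomp).sub_const _
  have hsum := (hF (comp t)).fun_add (HasDerivWithinAt.fun_sum (u := Finset.univ)
    fun i _ => (hcompi i).fun_smul (hF (e i)))
  refine (hsum.congr_of_eventuallyEq hexpand (hexpand.self_of_nhdsWithin ht)).congr_deriv ?_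
  have hend : ent (X.cof (C t) (chartField (γ t) c' (γ t))) = ∑ i, c' i • F (e i) (C t) := by
    have h1 : L (chartField (γ t) c' (γ t)) = ∑ i, c' i • L (chartField (γ t) (e i) (γ t)) := by
      rw [chartField_eq_sum hbase, map_sum]
      simp_rw [map_smul, e]
    change L (chartField (γ t) c' (γ t)) =
      ∑ i, c' i • X.cof (C t) (chartField (γ t) (e i) (X.π (C t)))
    rw [hx]
    exact h1
  have hpull : X.conn (C t) Cv = X.pull C t := rfl
  -- Removing from `C'` the horizontal lift of `γ'` leaves the vertical vector whose `A`-value is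
  -- `ω(C')`.
  have hvert : X.conn (C t) (Cv - X.hlift (C t) (vel t)) = blockPart (X.pull C t) := by
    rw [map_sub, ← cof_eq_conn_hlift, hcof t ht, hpull, offBlock_apply, sub_sub_cancel]
  have hmem : X.conn (C t) (Cv - X.hlift (C t) (vel t)) ∈ lieH k := by
    rw [hvert]; exact (X.omega (C t) Cv).2
  have hdecomp : X.dframeFun (chartField (γ t) (comp t)) (C t) Cv =
      ent (X.cof (C t) (X.nablaVec (chartField (γ t) (comp t)) (γ t) (vel t))) +
      ent (offBlock (X.pull C t) * blockPart (X.pull C t) -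
        blockPart (X.pull C t) * offBlock (X.pull C t)) := by
    have hv := dframeFun_vertical (hFd (comp t) (C t) hx) hmem
    rw [hx, hvel t hbase, hvert, hcof t ht] at hv
    rw [cof_nablaVec hx (hFd (comp t)), ← hv, ← map_add, add_sub_cancel]
  have hcov : (covDerivAlong X.inducedConnection γ (velocity γ) t : EuclideanSpace ℝ (Fin 4)) =
      chartField (γ t) c' (γ t) + X.nablaVec (chartField (γ t) (comp t)) (γ t) (vel t) := rfl
  rw [hcov, cof_add, hdecomp]
  -- The coefficients `comp s i - comp t i` vanish at `s = t`, so the derivatives of the `F (e i)`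
  -- drop out.
  simp only [sub_self, zero_smul, zero_add]
  rw [← hend]
  have hsub : ∀ a b c d : Mat, a + (b - c) + d = d + a - (c - b) := fun a b c d => by abel
  exact congrArg ent (hsub _ _ _ _)

end CartanGeometry

end CovariantDerivative

end SpacetimeCartan

namespace SpacetimeCartan

/-! ### The ambient form and the model space -/

variable {k : Model}

/-- The diagonal entries of the ambient form. -/
def weight (k : Model) : Idx → ℝ := Sum.elim ![-1, 1, 1, 1] fun _ => k.sign

lemma ambient_eq_diagonal (k : Model) : ambient k = Matrix.diagonal (weight k) := by
  rw [ambient, eta, Matrix.fromBlocks_diagonal]; rfl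

lemma form_eq_sum (v w : Vec) : form k v w = ∑ i, weight k i * v i * w i := by
  rw [form, ambient_eq_diagonal, dotProduct]
  refine Finset.sum_congr rfl fun i _ => ?_
  rw [Matrix.mulVec_diagonal]; ring

/-- The ambient form as a continuous bilinear map. -/
def formL (k : Model) : Vec →L[ℝ] Vec →L[ℝ] ℝ :=
  LinearMap.toContinuousBilinearMap (LinearMap.mk₂ ℝ (form k)
    (fun u v w => by simp only [form, add_dotProduct])
    (fun c u v => by simp only [form, smul_dotProduct])
    (fun u v w => by simp only [form, Matrix.mulVec_add, dotProduct_add])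
    (fun c u v => by simp only [form, Matrix.mulVec_smul, dotProduct_smul]))

lemma formL_apply (v w : Vec) : formL k v w = form k v w := rfl

lemma form_comm (v w : Vec) : form k v w = form k w v := by
  rw [form_eq_sum, form_eq_sum]
  exact Finset.sum_congr rfl fun i _ => by ring

lemma form_mulVec {g : Mat} (hg : g.transpose * ambient k * g = ambient k) (v w : Vec) :
    form k (g.mulVec v) (g.mulVec w) = form k v w := by
  rw [form, form, Matrix.mulVec_mulVec, Matrix.dotProduct_mulVec, ← Matrix.vecMul_transpose,
    Matrix.vecMul_vecMul, ← Matrix.mul_assoc, hg, ← Matrix.dotProduct_mulVec]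

/-- The Minkowski form on `ℝ⁴`. -/
def lorentz (v w : Fin 4 → ℝ) : ℝ := -(v 0 * w 0) + v 1 * w 1 + v 2 * w 2 + v 3 * w 3

lemma form_eq_lorentz (v w : Vec) : form k v w =
    lorentz (v ∘ Sum.inl) (w ∘ Sum.inl) + k.sign * v (Sum.inr 0) * w (Sum.inr 0) := by
  simp [form_eq_sum, Fintype.sum_sum_type, weight, lorentz, Fin.sum_univ_four]

lemma lorentz_nondegenerate {v : Fin 4 → ℝ} (hv : ∀ w, lorentz v w = 0) : v = 0 := by
  have h0 := hv (Pi.single 0 1)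
  have h1 := hv (Pi.single 1 1)
  have h2 := hv (Pi.single 2 1)
  have h3 := hv (Pi.single 3 1)
  simp [lorentz] at h0 h1 h2 h3
  ext i
  fin_cases i <;> simpa

/-- An element of `G` preserves the ambient form, or is an affine Lorentz transformation. -/
lemma G_cases (g : G k) : (mat g).transpose * ambient k * mat g = ambient k ∨
    k.sign = 0 ∧ ∃ (L : Matrix (Fin 4) (Fin 4) ℝ) (v : Matrix (Fin 4) (Fin 1) ℝ),
      L.transpose * eta * L = eta ∧ mat g = Matrix.fromBlocks L v 0 1 := by
  cases k with
  | deSitter => exact Or.inl (specialOrthogonal_of_mem_specialOrthogonalO g.2).1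
  | minkowski =>
    obtain ⟨L, hL, v, hg⟩ := g.2
    exact Or.inr ⟨rfl, L, v, (specialOrthogonal_of_mem_specialOrthogonalO hL).1, hg⟩
  | antiDeSitter => exact Or.inl (specialOrthogonal_of_mem_specialOrthogonalO g.2).1

lemma fromBlocks_affine_mulVec_inr (L : Matrix (Fin 4) (Fin 4) ℝ) (v : Matrix (Fin 4) (Fin 1) ℝ)
    (p : Vec) : (Matrix.fromBlocks L v 0 1 : Mat).mulVec p (Sum.inr 0) = p (Sum.inr 0) := by
  rw [Matrix.fromBlocks_mulVec]; simp

lemma mulVec_mem_space (g : G k) {p : Vec} (hp : p ∈ space k) : (mat g).mulVec p ∈ space k := by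
  cases k with
  | deSitter =>
    change form _ _ _ = 1
    exact (form_mulVec (specialOrthogonal_of_mem_specialOrthogonalO g.2).1 p p).trans hp
  | minkowski =>
    obtain ⟨L, hL, v, hg⟩ := g.2
    change (mat g).mulVec p (Sum.inr 0) = 1
    rw [mat, hg, fromBlocks_affine_mulVec_inr]
    exact hp
  | antiDeSitter =>
    change form _ _ _ = -1
    exact (form_mulVec (specialOrthogonal_of_mem_specialOrthogonalO g.2).1 p p).trans hp

/-- In the (anti-)de Sitter case `g` is an isometry and the last coordinate pairs with `0`. In the
Minkowski case the factor `sign` makes both last coordinates zero, and on such vectors only the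
Lorentz part of `g` acts. -/
lemma form_mulVec_tangent (g : G k) (u v : Fin 4 → ℝ) (c : ℝ) :
    form k ((mat g).mulVec (Sum.elim u fun _ => k.sign * c)) ((mat g).mulVec (Sum.elim v 0)) =
      lorentz u v := by
  rcases G_cases g with hg | ⟨hs, L, b, hL, hg⟩
  · rw [form_mulVec hg, form_eq_lorentz]
    simp
  · have h1 : ∀ a : Fin 4 → ℝ, (mat g).mulVec (Sum.elim a 0) =
        (Matrix.fromBlocks L 0 0 1 : Mat).mulVec (Sum.elim a 0) := by
      intro a
      rw [hg, Matrix.fromBlocks_mulVec, Matrix.fromBlocks_mulVec]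
      simp
    have h2 : (Matrix.fromBlocks L 0 0 1 : Mat).transpose * ambient k *
        Matrix.fromBlocks L 0 0 1 = ambient k := by
      rw [ambient, Matrix.fromBlocks_transpose, Matrix.fromBlocks_multiply,
        Matrix.fromBlocks_multiply]
      simp [hL]
    have h3 : (fun _ : Fin 1 => k.sign * c) = 0 := by rw [hs]; ext; simp
    rw [h3, h1, h1, form_mulVec h2, form_eq_lorentz]
    simp

lemma basePoint_mem_space : basePoint ∈ space k := by
  cases k with
  | deSitter => change form _ _ _ = 1; rw [form_eq_lorentz]; simp [basePoint, lorentz, Model.sign]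
  | minkowski => rfl
  | antiDeSitter =>
    change form _ _ _ = -1; rw [form_eq_lorentz]; simp [basePoint, lorentz, Model.sign]

/-- Near the base point, the model space is a graph over `ℝ⁴`. -/
lemma mem_space_iff_of_pos {p : Vec} (hp : 0 < p (Sum.inr 0)) (hpos : 0 ≤ 1 - k.sign *
    lorentz (p ∘ Sum.inl) (p ∘ Sum.inl)) : p ∈ space k ↔
      p (Sum.inr 0) = √(1 - k.sign * lorentz (p ∘ Sum.inl) (p ∘ Sum.inl)) := by
  have h1 : p (Sum.inr 0) = √(1 - k.sign * lorentz (p ∘ Sum.inl) (p ∘ Sum.inl)) ↔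
      1 - k.sign * lorentz (p ∘ Sum.inl) (p ∘ Sum.inl) = p (Sum.inr 0) ^ 2 := by
    rw [eq_comm, Real.sqrt_eq_iff_eq_sq hpos hp.le]
  rw [h1]
  cases k with
  | deSitter =>
    change form _ _ _ = 1 ↔ _
    rw [form_eq_lorentz]
    simp only [Model.sign]
    constructor <;> intro h <;> linarith
  | minkowski =>
    change p (Sum.inr 0) = 1 ↔ _
    simp only [Model.sign]
    constructor
    · intro h; rw [h]; ring
    · intro h; nlinarith
  | antiDeSitter =>
    change form _ _ _ = -1 ↔ _
    rw [form_eq_lorentz]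
    simp only [Model.sign]
    constructor <;> intro h <;> linarith

/-- The position vector of the model space is normal to it (with the factor `s` covering the affine
case). -/
lemma sign_mul_form_fderiv {φ : (Fin 4 → ℝ) → Vec} {u : Fin 4 → ℝ}
    (hφ : DifferentiableAt ℝ φ u) (hmem : ∀ᶠ y in 𝓝 u, φ y ∈ space k) (w : Fin 4 → ℝ) :
    k.sign * form k (φ u) (fderiv ℝ φ u w) = 0 := by
  have key : ∀ c : ℝ, (∀ᶠ y in 𝓝 u, form k (φ y) (φ y) = c) →
      form k (φ u) (fderiv ℝ φ u w) = 0 := by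
    intro c hc
    have h1 := (formL k).hasFDerivAt_of_bilinear hφ.hasFDerivAt hφ.hasFDerivAt
    have h2 : HasFDerivAt (fun y => formL k (φ y) (φ y)) (0 : (Fin 4 → ℝ) →L[ℝ] ℝ) u :=
      (hasFDerivAt_const c u).congr_of_eventuallyEq hc
    have h3 : form k (φ u) (fderiv ℝ φ u w) + form k (fderiv ℝ φ u w) (φ u) = 0 :=
      DFunLike.congr_fun (h1.unique h2) w
    rw [form_comm (fderiv ℝ φ u w)] at h3
    linarith
  cases k with
  | deSitter => rw [key 1 hmem, mul_zero]
  | minkowski => simp [Model.sign]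
  | antiDeSitter => rw [key (-1) hmem, mul_zero]

/-! ### The geodesic equation in a parametrization -/

lemma fderiv_pullbackMetric {φ : (Fin 4 → ℝ) → Vec} {u : Fin 4 → ℝ} (hφ : ContDiffAt ℝ ∞ φ u)
    (v w z : Fin 4 → ℝ) : fderiv ℝ (fun y => pullbackMetric k φ y v w) u z =
      form k (fderiv ℝ (fderiv ℝ φ) u z v) (fderiv ℝ φ u w) +
        form k (fderiv ℝ φ u v) (fderiv ℝ (fderiv ℝ φ) u z w) := by
  have hd : DifferentiableAt ℝ (fderiv ℝ φ) u :=
    (hφ.fderiv_right (m := 1) (by norm_cast)).differentiableAt (by simp)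
  have h1 : ∀ a : Fin 4 → ℝ, HasFDerivAt (fun y => fderiv ℝ φ y a)
      ((fderiv ℝ (fderiv ℝ φ) u).flip a) u := fun a => by
    have := hd.hasFDerivAt.clm_apply (hasFDerivAt_const a u)
    simpa using this
  have h2 := (formL k).hasFDerivAt_of_bilinear (h1 v) (h1 w)
  have h3 : fderiv ℝ (fun y => pullbackMetric k φ y v w) u = _ := h2.fderiv
  rw [h3]
  exact add_comm (form k (fderiv ℝ φ u v) (fderiv ℝ (fderiv ℝ φ) u z w)) _

/-- The left-hand side of the geodesic equation is the tangential part of the ambient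
acceleration. -/
lemma geodesic_expression_eq {φ : (Fin 4 → ℝ) → Vec} {x : ℝ → Fin 4 → ℝ} {y y₁ : ℝ → Vec}
    {y₂ : Vec} {t : ℝ} (ht : t ∈ Icc (0 : ℝ) 1) (hφ : ContDiffAt ℝ ∞ φ (x t))
    (hx : ContDiffWithinAt ℝ ∞ x (Icc 0 1) t) (hφx : ∀ᶠ s in 𝓝[Icc 0 1] t, φ (x s) = y s)
    (hy : ∀ s ∈ Icc (0 : ℝ) 1, HasDerivWithinAt y (y₁ s) (Icc 0 1) s)
    (hy₁ : HasDerivWithinAt y₁ y₂ (Icc 0 1) t) (w : Fin 4 → ℝ) :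
    pullbackMetric k φ (x t) (derivWithin (derivWithin x (Icc 0 1)) (Icc 0 1) t) w +
        (fderiv ℝ (fun u => pullbackMetric k φ u (derivWithin x (Icc 0 1) t) w) (x t)
            (derivWithin x (Icc 0 1) t) -
          (1 / 2) * fderiv ℝ (fun u => pullbackMetric k φ u (derivWithin x (Icc 0 1) t)
            (derivWithin x (Icc 0 1) t)) (x t) w) =
      form k y₂ (fderiv ℝ φ (x t) w) := by
  have hU : UniqueDiffOn ℝ (Icc (0 : ℝ) 1) := uniqueDiffOn_Icc_zero_one
  have hd : DifferentiableAt ℝ (fderiv ℝ φ) (x t) :=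
    (hφ.fderiv_right (m := 1) (by norm_cast)).differentiableAt (by simp)
  have hx' : DifferentiableWithinAt ℝ (derivWithin x (Icc 0 1)) (Icc 0 1) t := by
    have h1 : DifferentiableWithinAt ℝ (fderivWithin ℝ x (Icc 0 1)) (Icc 0 1) t :=
      (hx.fderivWithin_right (m := 1) hU (by norm_cast) ht).differentiableWithinAt (by simp)
    exact h1.clm_apply (differentiableWithinAt_const (1 : ℝ))
  have hxd : ∀ᶠ s in 𝓝[Icc 0 1] t, DifferentiableWithinAt ℝ x (Icc 0 1) s := by
    have h1 := (hx.of_le (m := 1) (by norm_cast)).eventually (by simp)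
    rw [insert_eq_of_mem ht] at h1
    filter_upwards [h1] with s hs using hs.differentiableWithinAt (by simp)
  have hφd : ∀ᶠ s in 𝓝[Icc 0 1] t, DifferentiableAt ℝ φ (x s) := by
    have h1 := (hφ.of_le (m := 1) (by norm_cast)).eventually (by simp)
    filter_upwards [hx.continuousWithinAt.eventually h1] with s hs using
      hs.differentiableAt (by simp)
  have hvel : ∀ᶠ s in 𝓝[Icc 0 1] t, y₁ s = fderiv ℝ φ (x s) (derivWithin x (Icc 0 1) s) := by
    filter_upwards [hxd, hφd, eventually_eventually_nhdsWithin.2 hφx, self_mem_nhdsWithin] with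
      s h1 h2 h3 hs
    have h4 := h2.hasFDerivAt.comp_hasDerivWithinAt s h1.hasDerivWithinAt
    have h5 := (hy s hs).congr_of_eventuallyEq h3 (h3.self_of_nhdsWithin hs)
    exact (hU s hs).eq_deriv _ h5 h4
  have hacc : y₂ = fderiv ℝ (fderiv ℝ φ) (x t) (derivWithin x (Icc 0 1) t)
      (derivWithin x (Icc 0 1) t) +
      fderiv ℝ φ (x t) (derivWithin (derivWithin x (Icc 0 1)) (Icc 0 1) t) := by
    have h1 := hd.hasFDerivAt.comp_hasDerivWithinAt t
      (hxd.self_of_nhdsWithin ht).hasDerivWithinAt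
    have h2 := h1.clm_apply hx'.hasDerivWithinAt
    have h3 := hy₁.congr_of_eventuallyEq (hvel.mono fun s hs => hs.symm)
      (hvel.self_of_nhdsWithin ht).symm
    exact (hU t ht).eq_deriv _ h3 h2
  -- Symmetry of `D²φ` cancels `⟨dφ v, D²φ(v, w)⟩` against half the `w`-derivative of `⟨dφ v, dφ
  -- v⟩`; what is left is `⟨dφ a + D²φ(v, v), dφ w⟩`.
  have hsymm := hφ.isSymmSndFDerivAt (n := ∞)
    (by rw [minSmoothness_of_isRCLikeNormedField]; norm_cast)
  rw [fderiv_pullbackMetric hφ, fderiv_pullbackMetric hφ, hacc, pullbackMetric]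
  rw [hsymm w]
  simp only [← formL_apply, map_add, add_apply]
  simp only [formL_apply]
  rw [form_comm (fderiv ℝ (fderiv ℝ φ) (x t) _ w)]
  ring

end SpacetimeCartan

namespace SpacetimeCartan

variable {k : Model}

/-! ### Paths in the group -/

/-- Bootstrapping: if `g` is `C^n` then so is `g' = g a`, hence `g` is `C^(n+1)`. A development only
provides a differentiable `g`. -/
lemma contDiffOn_of_hasDerivWithinAt_mul {g a : ℝ → Mat}
    (ha : ContDiffOn ℝ ∞ (fun s => ent (a s)) (Icc 0 1))
    (hg : ∀ t ∈ Icc (0 : ℝ) 1,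
      HasDerivWithinAt (fun s => ent (g s)) (ent (g t * a t)) (Icc 0 1) t) :
    ContDiffOn ℝ ∞ (fun s => ent (g s)) (Icc 0 1) := by
  refine contDiffOn_infty.2 fun n => ?_
  induction n with
  | zero => exact contDiffOn_zero.2 fun t ht => (hg t ht).continuousWithinAt
  | succ n ih =>
    have hmul : ContDiffOn ℝ n (fun s => ent (g s * a s)) (Icc 0 1) := by
      have hb : ContDiff ℝ n fun z : (Idx → Idx → ℝ) × (Idx → Idx → ℝ) =>
          ent (Matrix.of z.1 * Matrix.of z.2) := by
        refine contDiff_pi.2 fun i => contDiff_pi.2 fun j => ?_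
        simp only [ent, Matrix.mul_apply, Matrix.of_apply]
        fun_prop
      exact hb.comp_contDiffOn (ih.prodMk (contDiffOn_infty.1 ha n))
    push_cast
    refine (contDiffOn_succ_iff_derivWithin uniqueDiffOn_Icc_zero_one).2
      ⟨fun t ht => (hg t ht).differentiableWithinAt, by simp, hmul.congr fun t ht => ?_⟩
    exact (hg t ht).derivWithin (uniqueDiffOn_Icc_zero_one t ht)

lemma mulVec_basePoint (Y : Mat) : Y.mulVec basePoint = fun i => Y i (Sum.inr 0) := by
  ext i
  simp [Matrix.mulVec, dotProduct, basePoint, Fintype.sum_sum_type]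

lemma HasDerivWithinAt.mulVec_basePoint {A : ℝ → Mat} {A' : Mat} {S : Set ℝ} {t : ℝ}
    (hA : HasDerivWithinAt (fun s => ent (A s)) (ent A') S t) :
    HasDerivWithinAt (fun s => (A s).mulVec basePoint) (A'.mulVec basePoint) S t := by
  simp_rw [SpacetimeCartan.mulVec_basePoint]
  exact hasDerivWithinAt_pi.2 fun i =>
    hasDerivWithinAt_pi.1 (hasDerivWithinAt_pi.1 hA i) (Sum.inr 0)

lemma blockPart_mulVec_basePoint (Y : Mat) : (blockPart Y).mulVec basePoint = 0 := by
  rw [mulVec_basePoint]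
  ext (i | i) <;> simp [blockPart]

lemma offBlock_mem {Y : Mat} (hY : Y ∈ lieG k) : offBlock Y ∈ lieP k :=
  ⟨sub_mem hY (blockPart_mem hY), by simp [offBlock_apply, blockPart_blockPart]⟩

/-- The square of an element of `𝔭` sends the base point to a multiple of itself with factor `sign`:
this is the normal part of the acceleration. -/
lemma mul_add_mulVec_basePoint (v b : Matrix (Fin 4) (Fin 1) ℝ) :
    (transvection k v * transvection k v + transvection k b).mulVec basePoint =
      Sum.elim (fun i => b i 0) fun _ => k.sign * -(v.transpose * eta * v) 0 0 := by
  rw [mulVec_basePoint, transvection, transvection, Matrix.fromBlocks_multiply,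
    Matrix.fromBlocks_add]
  ext (i | i)
  · simp
  · simp [Subsingleton.elim i 0]

/-! ### Graph parametrizations of the model space -/

/-- The graph parametrization of the model space at the base point, moved by `g`. -/
def graphChart (g : G k) (u : Fin 4 → ℝ) : Vec :=
  (mat g).mulVec (Sum.elim u fun _ => √(1 - k.sign * lorentz u u))

lemma contDiff_lorentz_self : ContDiff ℝ ∞ fun u : Fin 4 → ℝ => lorentz u u := by
  unfold lorentz
  fun_prop

lemma contDiffAt_graphChart (g : G k) : ContDiffAt ℝ ∞ (graphChart g) 0 := by
  have h1 : ContDiffAt ℝ ∞ (fun u : Fin 4 → ℝ => 1 - k.sign * lorentz u u) 0 :=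
    (contDiff_const.sub (contDiff_const.mul contDiff_lorentz_self)).contDiffAt
  have h2 : ContDiffAt ℝ ∞ (fun u : Fin 4 → ℝ => √(1 - k.sign * lorentz u u)) 0 :=
    h1.sqrt (by simp [lorentz])
  have h3 : ContDiffAt ℝ ∞ (fun u : Fin 4 → ℝ =>
      (Sum.elim u fun _ => √(1 - k.sign * lorentz u u) : Vec)) 0 := by
    refine contDiffAt_pi.2 fun i => ?_
    rcases i with i | i
    · exact (contDiff_apply ℝ ℝ i).contDiffAt
    · exact h2
  exact (LinearMap.toContinuousLinearMap (Matrix.mulVecLin (mat g))).contDiff.contDiffAt.comp 0 h3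

/-- The last coordinate is even in `u`, so it is stationary at `0`; the derivative is computed along
the lines `r ↦ r • w`. -/
lemma fderiv_graphChart (g : G k) (w : Fin 4 → ℝ) :
    fderiv ℝ (graphChart g) 0 w = (mat g).mulVec (Sum.elim w 0) := by
  have hd := ((contDiffAt_graphChart g).differentiableAt (by simp)).hasFDerivAt
  have h1 : HasDerivAt (fun r : ℝ => graphChart g (r • w)) (fderiv ℝ (graphChart g) 0 w) 0 := by
    have h2 : HasDerivAt (fun r : ℝ => r • w) w 0 := by
      simpa using (hasDerivAt_id (0 : ℝ)).smul_const w
    rw [← zero_smul ℝ w] at hd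
    exact (hd.comp_hasDerivAt (0 : ℝ) h2).congr_deriv (by rw [zero_smul])
  have h3 : HasDerivAt (fun r : ℝ => √(1 - k.sign * lorentz (r • w) (r • w))) 0 0 := by
    have h4 : ∀ r : ℝ, lorentz (r • w) (r • w) = r ^ 2 * lorentz w w := fun r => by
      simp [lorentz]; ring
    simp_rw [h4]
    have h5 : HasDerivAt (fun r : ℝ => 1 - k.sign * (r ^ 2 * lorentz w w)) 0 0 := by
      have := ((((hasDerivAt_id (0 : ℝ)).pow 2).mul_const (lorentz w w)).const_mul
        k.sign).const_sub 1
      simpa using this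
    simpa using h5.sqrt (by simp)
  have h6 : HasDerivAt (fun r : ℝ =>
      (Sum.elim (r • w) fun _ => √(1 - k.sign * lorentz (r • w) (r • w)) : Vec))
      (Sum.elim w 0) 0 := by
    refine hasDerivAt_pi.2 fun i => ?_
    rcases i with i | i
    · simpa using (hasDerivAt_id (0 : ℝ)).mul_const (w i)
    · exact h3
  exact h1.unique ((LinearMap.toContinuousLinearMap
    (Matrix.mulVecLin (mat g))).hasFDerivAt.comp_hasDerivAt (0 : ℝ) h6)

lemma mat_inv_mulVec (g : G k) (v : Vec) : (mat g⁻¹).mulVec ((mat g).mulVec v) = v := by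
  rw [Matrix.mulVec_mulVec, mat_inv_mul, Matrix.one_mulVec]

lemma mat_mulVec_inv (g : G k) (v : Vec) : (mat g).mulVec ((mat g⁻¹).mulVec v) = v := by
  rw [Matrix.mulVec_mulVec, mat_mul_inv, Matrix.one_mulVec]

lemma fderiv_graphChart_injective (g : G k) :
    Function.Injective (fderiv ℝ (graphChart g) (0 : Fin 4 → ℝ)) := by
  intro v w h
  rw [fderiv_graphChart, fderiv_graphChart] at h
  have := congrArg ((mat g⁻¹).mulVec) h
  rw [mat_inv_mulVec, mat_inv_mulVec] at this
  ext i
  exact congrFun this (Sum.inl i)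

lemma eventually_one_sub_pos : ∀ᶠ u : Fin 4 → ℝ in 𝓝 0, 0 < 1 - k.sign * lorentz u u := by
  have h : ContinuousAt (fun u : Fin 4 → ℝ => 1 - k.sign * lorentz u u) 0 :=
    (continuous_const.sub (continuous_const.mul contDiff_lorentz_self.continuous)).continuousAt
  exact h.eventually (lt_mem_nhds (by simp [lorentz]))

lemma eventually_graphChart_mem (g : G k) : ∀ᶠ u in 𝓝 0, graphChart g u ∈ space k := by
  filter_upwards [eventually_one_sub_pos (k := k)] with u hu
  exact mulVec_mem_space g
    ((mem_space_iff_of_pos (p := Sum.elim u fun _ => √(1 - k.sign * lorentz u u))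
      (Real.sqrt_pos.2 hu) hu.le).2 rfl)

/-! ### Geodesics of the model space -/

/-- A path `σ = g H` with `g⁻¹ g' = a` is a geodesic iff the covariant derivative `K` of the
`𝔭`-part of `a` along the `𝔥`-part vanishes. -/
lemma isModelGeodesic_iff {σ : ℝ → G k ⧸ H k} {g : ℝ → G k} {a K : ℝ → Mat}
    (has : ContDiffOn ℝ ∞ (fun s => ent (a s)) (Icc 0 1))
    (ha : ∀ t ∈ Icc (0 : ℝ) 1, a t ∈ lieG k) (hK : ∀ t ∈ Icc (0 : ℝ) 1, K t ∈ lieP k)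
    (hg : ∀ t ∈ Icc (0 : ℝ) 1, HasDerivWithinAt (fun s => ent (mat (g s)))
      (ent (mat (g t) * a t)) (Icc 0 1) t)
    (hσ : ∀ t ∈ Icc (0 : ℝ) 1, σ t = (g t : G k ⧸ H k))
    (hd : ∀ t ∈ Icc (0 : ℝ) 1, HasDerivWithinAt (fun s => ent (offBlock (a s)))
      (ent (K t - (blockPart (a t) * offBlock (a t) - offBlock (a t) * blockPart (a t))))
      (Icc 0 1) t) :
    IsModelGeodesic k σ ↔ ∀ t ∈ Icc (0 : ℝ) 1, K t = 0 := by
  have horb : ∀ t ∈ Icc (0 : ℝ) 1, orbit (σ t) = (mat (g t)).mulVec basePoint := fun t ht => by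
    rw [hσ t ht]; rfl
  have hsmooth : ContDiffOn ℝ ∞ (fun t => orbit (σ t)) (Icc 0 1) := by
    have h1 := contDiffOn_of_hasDerivWithinAt_mul has hg
    refine ContDiffOn.congr (f := fun t => (mat (g t)).mulVec basePoint) ?_ horb
    simp_rw [mulVec_basePoint]
    exact contDiffOn_pi.2 fun i => contDiffOn_pi.1 (contDiffOn_pi.1 h1 i) (Sum.inr 0)
  have hy : ∀ s ∈ Icc (0 : ℝ) 1, HasDerivWithinAt (fun t => orbit (σ t))
      ((mat (g s) * offBlock (a s)).mulVec basePoint) (Icc 0 1) s := by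
    intro s hs
    have h1 := HasDerivWithinAt.mulVec_basePoint (hg s hs)
    refine (h1.congr horb (horb s hs)).congr_deriv ?_
    rw [offBlock_apply, mul_sub, Matrix.sub_mulVec, ← Matrix.mulVec_mulVec (basePoint) _
      (blockPart _), blockPart_mulVec_basePoint, Matrix.mulVec_zero, sub_zero]
  have hacc : ∀ t ∈ Icc (0 : ℝ) 1, ∃ (b : Matrix (Fin 4) (Fin 1) ℝ) (c : ℝ),
      K t = transvection k b ∧ HasDerivWithinAt (fun s =>
        (mat (g s) * offBlock (a s)).mulVec basePoint)
        ((mat (g t)).mulVec (Sum.elim (fun i => b i 0) fun _ => k.sign * c)) (Icc 0 1) t := by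
    intro t ht
    obtain ⟨b, hb⟩ := mem_lieP_iff.1 (hK t ht)
    obtain ⟨v, hv⟩ := mem_lieP_iff.1 (offBlock_mem (ha t ht))
    refine ⟨b, -(v.transpose * eta * v) 0 0, hb, ?_⟩
    refine (HasDerivWithinAt.mulVec_basePoint
      (hasDerivWithinAt_ent_mul (hg t ht) (hd t ht))).congr_deriv ?_
    have hat : a t = blockPart (a t) + offBlock (a t) := by rw [offBlock_apply]; abel
    -- With `a = ω + e`, the term `ω e` from `g'` cancels the one from `e'`. The surviving `e ω`
    -- ends in `ω`, which kills the base point.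
    have h1 : mat (g t) * a t * offBlock (a t) + mat (g t) * (K t -
        (blockPart (a t) * offBlock (a t) - offBlock (a t) * blockPart (a t))) =
        mat (g t) * (offBlock (a t) * offBlock (a t) + K t) +
          mat (g t) * offBlock (a t) * blockPart (a t) := by
      conv_lhs => rw [show mat (g t) * a t = mat (g t) * (blockPart (a t) + offBlock (a t)) by
        rw [← hat]]
      noncomm_ring
    rw [h1, Matrix.add_mulVec, ← Matrix.mulVec_mulVec basePoint _ (blockPart _),
      blockPart_mulVec_basePoint, Matrix.mulVec_zero, add_zero, hv, hb, ← Matrix.mulVec_mulVec,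
      mul_add_mulVec_basePoint]
  constructor
  · rintro ⟨-, h⟩ t ht
    obtain ⟨b, c, hb, hy₂⟩ := hacc t ht
    -- For this direction one parametrization suffices: the graph chart moved by `g t`, in which the
    -- path sits at `0` at time `t`.
    let x : ℝ → Fin 4 → ℝ := fun s => ((mat (g t)⁻¹).mulVec (orbit (σ s))) ∘ Sum.inl
    have hbase : (mat (g t)⁻¹).mulVec (orbit (σ t)) = basePoint := by
      rw [horb t ht, mat_inv_mulVec]
    have hxt : x t = 0 := by
      change ((mat (g t)⁻¹).mulVec (orbit (σ t))) ∘ Sum.inl = 0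
      rw [hbase]; rfl
    have hlin : ContDiffOn ℝ ∞ (fun s => (mat (g t)⁻¹).mulVec (orbit (σ s))) (Icc 0 1) :=
      (LinearMap.toContinuousLinearMap (Matrix.mulVecLin (mat (g t)⁻¹))).contDiff.comp_contDiffOn
        hsmooth
    have hx : ContDiffWithinAt ℝ ∞ x (Icc 0 1) t :=
      contDiffWithinAt_pi.2 fun i => contDiffWithinAt_pi.1 (hlin t ht) (Sum.inl i)
    have hφx : ∀ᶠ s in 𝓝[Icc 0 1] t, graphChart (g t) (x s) = orbit (σ s) := by
      have h1 : ∀ᶠ s in 𝓝[Icc 0 1] t, 0 < (mat (g t)⁻¹).mulVec (orbit (σ s)) (Sum.inr 0) := by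
        have h2 : ContinuousWithinAt
            (fun s => (mat (g t)⁻¹).mulVec (orbit (σ s)) (Sum.inr 0)) (Icc 0 1) t :=
          (continuous_apply (Sum.inr 0)).continuousAt.comp_continuousWithinAt
            (hlin t ht).continuousWithinAt
        refine h2.eventually (lt_mem_nhds ?_)
        beta_reduce
        rw [hbase]; simp [basePoint]
      have h3 : ∀ᶠ s in 𝓝[Icc 0 1] t, 0 < 1 - k.sign * lorentz (x s) (x s) := by
        have h2 := hx.continuousWithinAt.tendsto
        rw [hxt] at h2
        exact h2.eventually eventually_one_sub_pos
      filter_upwards [h1, h3, self_mem_nhdsWithin] with s hs hs' hsI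
      have hmem : (mat (g t)⁻¹).mulVec (orbit (σ s)) ∈ space k := by
        rw [horb s hsI]
        exact mulVec_mem_space _ (mulVec_mem_space _ basePoint_mem_space)
      have h4 := (mem_space_iff_of_pos hs hs'.le).1 hmem
      have h5 : (Sum.elim (x s) fun _ => √(1 - k.sign * lorentz (x s) (x s)) : Vec) =
          (mat (g t)⁻¹).mulVec (orbit (σ s)) := by
        ext (i | i)
        · rfl
        · rw [Subsingleton.elim i 0]; exact h4.symm
      rw [graphChart, h5, mat_mulVec_inv]
    have hφ : ContDiffAt ℝ ∞ (graphChart (g t)) (x t) := by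
      rw [hxt]; exact contDiffAt_graphChart (g t)
    have hgeo := h t ht (graphChart (g t)) x hφ
      (by rw [hxt]; exact fderiv_graphChart_injective (g t))
      (by rw [hxt]; exact eventually_graphChart_mem (g t)) hx hφx
    have hzero : (fun i => b i 0) = (0 : Fin 4 → ℝ) := by
      refine lorentz_nondegenerate fun w => ?_
      -- The geodesic equation becomes `lorentz b w = 0`, the normal component having dropped out;
      -- nondegeneracy then gives `b = 0`.
      have h1 := hgeo w
      rw [geodesic_expression_eq ht hφ hx hφx hy hy₂, hxt, fderiv_graphChart,
        form_mulVec_tangent] at h1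
      exact h1
    have hb0 : b = 0 := by
      ext i j
      rw [Subsingleton.elim j 0]
      exact congrFun hzero i
    rw [hb, hb0]
    simp [transvection]
  · intro h
    refine ⟨hsmooth, fun t ht φ x hφ _ hmem hx hφx => ?_⟩
    intro v acc w
    obtain ⟨b, c, hb, hy₂⟩ := hacc t ht
    have hb0 : b = 0 := by
      have h1 : transvection k b = 0 := hb ▸ h t ht
      exact congrArg Matrix.toBlocks₁₂ h1
    have h2 : (Sum.elim (fun i => b i 0) fun _ => k.sign * c : Vec) =
        (k.sign * c) • basePoint := by
      ext (i | i) <;> simp [hb0, basePoint]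
    -- With `K = 0` the acceleration is `sign * c` times the position vector, which is normal to the
    -- model space in every parametrization.
    have h3 : (mat (g t)).mulVec (Sum.elim (fun i => b i 0) fun _ => k.sign * c) =
        (k.sign * c) • φ (x t) := by
      rw [h2, Matrix.mulVec_smul, hφx.self_of_nhdsWithin ht, horb t ht]
    refine (geodesic_expression_eq ht hφ hx hφx hy hy₂ w).trans ?_
    rw [h3, ← formL_apply, map_smul, smul_apply, formL_apply, smul_eq_mul]
    linear_combination c * sign_mul_form_fderiv (hφ.differentiableAt (by simp)) hmem w

end SpacetimeCartan

end

theorem mainTheorem5 (k : SpacetimeCartan.Model) {M P : Type*}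
    [TopologicalSpace M] [T2Space M] [ChartedSpace (EuclideanSpace ℝ (Fin 4)) M]
    [IsManifold (𝓡 4) ∞ M]
    [TopologicalSpace P] [T2Space P] [ChartedSpace (EuclideanSpace ℝ (Fin 10)) P]
    [IsManifold (𝓡 10) ∞ P]
    [MulAction (SpacetimeCartan.H k)ᵐᵒᵖ P]
    (X : SpacetimeCartan.CartanGeometry k M P)
    (γ : ℝ → M) (hγ : ContMDiffOn 𝓘(ℝ, ℝ) (𝓡 4) ∞ γ (Set.Icc 0 1))
    (σ : ℝ → SpacetimeCartan.G k ⧸ SpacetimeCartan.H k) (hσ : X.IsDevelopment γ σ) :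
    SpacetimeCartan.IsGeodesic X.inducedConnection γ ↔ SpacetimeCartan.IsModelGeodesic k σ := by
  obtain ⟨C, hC, hπ, g, hg, hσ⟩ := hσ
  -- Here `a = A(C')`, and `K` is the coframe of `∇_{γ'} γ'` in the frame `C t`; it remains only
  -- that the coframe is injective and sends `0` to `0`.
  rw [SpacetimeCartan.isModelGeodesic_iff
    (SpacetimeCartan.CartanGeometry.contDiffOn_pull (X := X) hC) (fun t _ => X.conn_mem _ _)
    (fun t _ => X.cof_mem (C t) _) hg hσ fun t ht =>
      SpacetimeCartan.CartanGeometry.hasDerivWithinAt_cof_velocity hγ hC hπ ht]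
  refine ⟨fun h t ht => ?_, fun h => ⟨hγ, fun t ht => ?_⟩⟩
  · rw [h.2 t ht]
    exact X.cof_zero (C t)
  · refine X.cof_injective (C t) ((h t ht).trans ?_)
    exact (X.cof_zero (C t)).symm
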